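/- Let $\mathcal G_{IV}$ be the graph on four parties $A,B,C,D$ (one qubit each) with the five edges $AB, AC, AD, BC, BD$, so that $A,B$ have 3 edges and $C,D$ have 2 edges. For $x=(x_A,x_B,x_C,x_D)$ with $x_i\ge 0$ and $x_0:=1-\sum_i x_i\ge 0$, write $|x\rangle=\sqrt{x_0}|0000\rangle+\sqrt{x_A}|1000\rangle+\sqrt{x_B}|0100\rangle+\sqrt{x_C}|0010\rangle+\sqrt{x_D}|0001\rangle$. A W-class state (degenerate cases included) is a pure state equivalent to some $|x\rangle$ under local unitaries; $x$ is called a component vector of the state, where, if exactly two of the $x_i$ are nonzero, one requires in addition $x_0=0$. Let $n_1$ be a party with the largest component, $n_1'$ a party with the largest component among those whose number of edges differs from that of $n_1$, and $e_2,e_3$ the remaining two parties, having 2 and 3 edges respectively. Define $$\Gamma(x)=\begin{cases}2x_{e_3}+(x_{e_2}+x_{n_1'})\left(2-\frac{x_{e_3}}{x_{n_1}}\right)-2\frac{x_{n_1'}x_{e_2}}{x_{n_1}}+\frac43\frac{x_{e_2}x_{e_3}x_{n_1'}}{x_{n_1}^2}&\text{if } n_1 \text{ has 3 edges},\\[2mm]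 2x_{n_1'}+2x_{e_3}-\frac{x_{n_1'}x_{e_3}}{x_{n_1}}+\frac{x_{e_2}x_{e_3}x_{n_1'}}{3x_{n_1}^2}&\text{if } n_1\text{ has 2 edges,}\end{cases}$$ and $\Gamma(0)=0$. Then $\Gamma(x)$ does not depend on the choice of the parties at ties, it takes the same value at all component vectors of a W-class state, and so defines a function on W-class states. This function is an entanglement monotone: every state obtained with nonzero probability from a W-class state $\psi$ by a finite-round LOCC protocol (adaptive local measurements on the qubits) is again W-class, and if the final states $\psi_\lambda$ occur with probabilities $p_\lambda$, then $\sum_\lambda p_\lambda\Gamma(\psi_\lambda)\le\Gamma(\psi)$. Consequently, for every $x$ with $x_i\ge0$ and $\sum_i x_i\le 1$, the supremum $P(x,\mathcal G_{IV})$, over all finite-round LOCC protocols, of the probability that $|x\rangle$ is transformed into an EPR pair shared by two parties joined by an edge of $\mathcal G_{IV}$ (the other two parties being disentangled) satisfies $P(x,\mathcal G_{IV})\le\Gamma(x)$. Moreover $\Gamma(W_4)=5/6$, where $W_4=(\tfrac14,\tfrac14,\tfrac14,\tfrac14)$. -/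

import Mathlib

noncomputable section

/-! Parties `A, B, C, D` are `0, 1, 2, 3 : Fin 4`. -/

/-- A (not necessarily normalized) vector of the four-qubit space, given by its amplitudes in the
computational basis. -/
abbrev Ket : Type := (Fin 4 → Fin 2) → ℂ

/-- An operator on one qubit. -/
abbrev QubitOp : Type := Matrix (Fin 2) (Fin 2) ℂ

/-- Squared Euclidean norm. For a post-measurement vector this is the probability of the outcome. -/
def prob (ψ : Ket) : ℝ := ∑ s, ‖ψ s‖ ^ 2

/-- The unit vector in the direction of `ψ` (zero if `ψ = 0`). -/
def unitKet (ψ : Ket) : Ket := (((Real.sqrt (prob ψ))⁻¹ : ℝ) : ℂ) • ψ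

/-- The operator `M` on the qubit of party `k`, the identity on the other qubits. -/
def applyAt (k : Fin 4) (M : QubitOp) (ψ : Ket) : Ket :=
  fun s => ∑ b, M (s k) b * ψ (Function.update s k b)

/-- The tensor product `U 0 ⊗ U 1 ⊗ U 2 ⊗ U 3`. -/
def applyAll (U : Fin 4 → QubitOp) (ψ : Ket) : Ket :=
  fun s => ∑ t, (∏ k, U k (s k) (t k)) * ψ t

/-- Equivalence under local unitaries. -/
def LUEquiv (ψ φ : Ket) : Prop :=
  ∃ U : Fin 4 → QubitOp, (∀ k, U k ∈ Matrix.unitaryGroup (Fin 2) ℂ) ∧ φ = applyAll U ψ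

/-! ### LOCC -/

/-- A finite-round LOCC protocol on pure states. It either ends, or some party `k` performs a
complete measurement with finitely many outcomes, the outcome is announced, and the protocol goes
on in a way that may depend on it. Local unitaries are the case of a single outcome. -/
inductive Protocol : Type
  | done : Protocol
  | measure (k : Fin 4) (m : ℕ) (M : Fin m → QubitOp)
      (complete : ∑ l, (M l).conjTranspose * M l = 1) (next : Fin m → Protocol) : Protocol

/-- The unnormalized final vectors of all branches of the protocol. -/
def Protocol.outcomes : Protocol → Ket → Multiset Ket
  | .done, ψ => {ψ}
  | .measure k _ M _ next, ψ => ∑ l, (next l).outcomes (applyAt k (M l) ψ)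

/-- Expected value of `μ` at the final state. -/
def Protocol.average (P : Protocol) (μ : Ket → ℝ) (ψ : Ket) : ℝ :=
  ((P.outcomes ψ).map fun φ => prob φ * μ (unitKet φ)).sum

/-- `μ` is an entanglement monotone on the set `S` of pure states: `S` is closed under LOCC, and
`μ` does not increase on average under LOCC. -/
def IsEntanglementMonotone (S : Set Ket) (μ : Ket → ℝ) : Prop :=
  ∀ ψ ∈ S, ∀ P : Protocol,
    (∀ φ ∈ P.outcomes ψ, φ ≠ 0 → unitKet φ ∈ S) ∧ P.average μ ψ ≤ μ ψ

/-! ### Random distillation of EPR pairs -/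

/-- The EPR state `(|00⟩ + |11⟩) / √2` of parties `i ≠ j`, the other two being in state `|0⟩`. -/
def epr (i j : Fin 4) : Ket := fun s =>
  if s = 0 ∨ s = Pi.single i 1 + Pi.single j 1 then (((Real.sqrt 2)⁻¹ : ℝ) : ℂ) else 0

/-- Some pair joined by an edge of `G` shares an EPR state, up to local unitaries. -/
def IsTarget (G : SimpleGraph (Fin 4)) (ψ : Ket) : Prop :=
  ∃ i j, G.Adj i j ∧ LUEquiv (epr i j) ψ

open Classical in
/-- The probability that `P`, started in `ψ`, ends with an EPR state along an edge of `G`. -/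
def Protocol.successProb (P : Protocol) (G : SimpleGraph (Fin 4)) (ψ : Ket) : ℝ :=
  P.average (fun φ => if IsTarget G φ then 1 else 0) ψ

/-- The optimal LOCC probability of random distillation from `ψ` with configuration graph `G`. -/
def distillProb (ψ : Ket) (G : SimpleGraph (Fin 4)) : ℝ :=
  ⨆ P : Protocol, P.successProb G ψ

/-! ### W-class states -/

/-- `√x₀|0000⟩ + √x_A|1000⟩ + √x_B|0100⟩ + √x_C|0010⟩ + √x_D|0001⟩`, `x₀ = 1 - ∑ i, x i`. -/
def wKet (x : Fin 4 → ℝ) : Ket := fun s =>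
  if s = 0 then ((Real.sqrt (1 - ∑ i, x i) : ℝ) : ℂ)
  else ∑ i, if s = Pi.single i 1 then ((Real.sqrt (x i) : ℝ) : ℂ) else 0

/-- `x` gives a normalized vector `wKet x`. -/
def IsComponents (x : Fin 4 → ℝ) : Prop := (∀ i, 0 ≤ x i) ∧ ∑ i, x i ≤ 1

/-- The vectors that represent states: if exactly two parties are entangled, the components are
not invariant under local unitaries, and are fixed by demanding `x₀ = 0`. -/
def IsWVector (x : Fin 4 → ℝ) : Prop :=
  IsComponents x ∧ ({i | x i ≠ 0}.ncard = 2 → ∑ i, x i = 1)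

/-- Pure four-qubit states of the W form, including the degenerate ones in which some parties are
no longer entangled with the rest. -/
def WClass : Set Ket := {ψ | ∃ x, IsWVector x ∧ LUEquiv (wKet x) ψ}

/-! ### Configuration IV and the function `Γ` -/

/-- The graph with edges `AB, BD, AD, AC, BC`. -/
def graphIV : SimpleGraph (Fin 4) :=
  SimpleGraph.fromEdgeSet {s(0, 1), s(1, 3), s(0, 3), s(0, 2), s(1, 2)}

/-- The number of edges at the node `k`. -/
def numEdges (k : Fin 4) : ℕ := (graphIV.neighborSet k).ncard

/-- The parties that occur in the definition of `Γ`; `n1c` is the edge-complementary party. -/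
structure Roles : Type where
  n1 : Fin 4
  n1c : Fin 4
  e2 : Fin 4
  e3 : Fin 4

/-- `n1` has a largest component, `n1c` has a largest component among the parties whose number of
edges differs from that of `n1`, and `e2`, `e3` are the other two parties, with 2 and 3 edges. -/
structure Roles.Valid (r : Roles) (x : Fin 4 → ℝ) : Prop where
  max_n1 : ∀ k, x k ≤ x r.n1
  compl : numEdges r.n1c ≠ numEdges r.n1
  max_n1c : ∀ k, numEdges k ≠ numEdges r.n1 → x k ≤ x r.n1c
  e2_other : r.e2 ≠ r.n1 ∧ r.e2 ≠ r.n1c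
  e3_other : r.e3 ≠ r.n1 ∧ r.e3 ≠ r.n1c
  e2_edges : numEdges r.e2 = 2
  e3_edges : numEdges r.e3 = 3

/-- The defining expression of `Γ` for a given choice of the parties. -/
def gammaFormula (x : Fin 4 → ℝ) (r : Roles) : ℝ :=
  if numEdges r.n1 = 3 then
    2 * x r.e3 + (x r.e2 + x r.n1c) * (2 - x r.e3 / x r.n1) - 2 * (x r.n1c * x r.e2 / x r.n1)
      + 4 / 3 * (x r.e2 * x r.e3 * x r.n1c / x r.n1 ^ 2)
  else
    2 * x r.n1c + 2 * x r.e3 - x r.n1c * x r.e3 / x r.n1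
      + x r.e2 * x r.e3 * x r.n1c / (3 * x r.n1 ^ 2)

theorem numEdges_eq (k : Fin 4) : numEdges k = if k = 0 ∨ k = 1 then 3 else 2 := by
  have h : ∀ (s : Finset (Fin 4)), graphIV.neighborSet k = (s : Set (Fin 4)) →
      numEdges k = s.card := by
    intro s hs
    rw [numEdges, hs, Set.ncard_coe_finset]
  fin_cases k
  · rw [h {1, 2, 3} (by ext j; fin_cases j <;> simp [graphIV])]; rfl
  · rw [h {0, 2, 3} (by ext j; fin_cases j <;> simp [graphIV])]; rfl
  · rw [h {0, 1} (by ext j; fin_cases j <;> simp [graphIV])]; rfl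
  · rw [h {0, 1} (by ext j; fin_cases j <;> simp [graphIV])]; rfl

theorem exists_roles (x : Fin 4 → ℝ) : ∃ r : Roles, r.Valid x := by
  obtain ⟨n, hn⟩ := Finite.exists_max x
  by_cases h3 : n = 0 ∨ n = 1
  · obtain ⟨o, ho⟩ : ∃ o : Fin 4, o ≠ n ∧ (o = 0 ∨ o = 1) := by
      rcases h3 with rfl | rfl
      · exact ⟨1, by decide⟩
      · exact ⟨0, by decide⟩
    rcases le_total (x 2) (x 3) with h | h
    · refine ⟨⟨n, 3, 2, o⟩, hn, ?_, ?_, ?_, ?_, ?_, ?_⟩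
      · rcases h3 with rfl | rfl <;> simp [numEdges_eq]
      · intro k
        rcases h3 with rfl | rfl <;> fin_cases k <;> simp [numEdges_eq, h]
      · rcases h3 with rfl | rfl <;> simp
      · rcases ho with ⟨h1, rfl | rfl⟩ <;> simp [h1]
      · simp [numEdges_eq]
      · simp [numEdges_eq, ho.2]
    · refine ⟨⟨n, 2, 3, o⟩, hn, ?_, ?_, ?_, ?_, ?_, ?_⟩
      · rcases h3 with rfl | rfl <;> simp [numEdges_eq]
      · intro k
        rcases h3 with rfl | rfl <;> fin_cases k <;> simp [numEdges_eq, h]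
      · rcases h3 with rfl | rfl <;> simp
      · rcases ho with ⟨h1, rfl | rfl⟩ <;> simp [h1]
      · simp [numEdges_eq]
      · simp [numEdges_eq, ho.2]
  · have h2 : n = 2 ∨ n = 3 := by
      fin_cases n <;> simp_all
    obtain ⟨o, ho⟩ : ∃ o : Fin 4, o ≠ n ∧ (o = 2 ∨ o = 3) := by
      rcases h2 with rfl | rfl
      · exact ⟨3, by decide⟩
      · exact ⟨2, by decide⟩
    rcases le_total (x 0) (x 1) with h | h
    · refine ⟨⟨n, 1, o, 0⟩, hn, ?_, ?_, ?_, ?_, ?_, ?_⟩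
      · rcases h2 with rfl | rfl <;> simp [numEdges_eq]
      · intro k
        rcases h2 with rfl | rfl <;> fin_cases k <;> simp [numEdges_eq, h]
      · rcases ho with ⟨h1, rfl | rfl⟩ <;> simp [h1]
      · rcases h2 with rfl | rfl <;> simp
      · rcases ho with ⟨h1, rfl | rfl⟩ <;> simp [numEdges_eq]
      · simp [numEdges_eq]
    · refine ⟨⟨n, 0, o, 1⟩, hn, ?_, ?_, ?_, ?_, ?_, ?_⟩
      · rcases h2 with rfl | rfl <;> simp [numEdges_eq]
      · intro k
        rcases h2 with rfl | rfl <;> fin_cases k <;> simp [numEdges_eq, h]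
      · rcases ho with ⟨h1, rfl | rfl⟩ <;> simp [h1]
      · rcases h2 with rfl | rfl <;> simp
      · rcases ho with ⟨h1, rfl | rfl⟩ <;> simp [numEdges_eq]
      · simp [numEdges_eq]

/-- The function `Γ` of the component vector. -/
def Gamma (x : Fin 4 → ℝ) : ℝ := gammaFormula x (exists_roles x).choose

open Classical in
/-- The function `Γ` on W-class states: its value at a component vector of the state. -/
def GammaState (ψ : Ket) : ℝ :=
  if h : ∃ x, IsWVector x ∧ LUEquiv (wKet x) ψ then Gamma h.choose else 0

end

/-! ### The function `Γ` of the components -/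

/-! The monotonicity rests on two properties of `Gamma`: it is homogeneous of degree one
(`Gamma_smul`), and it is nondecreasing and concave in each single component
(`exists_supergradient_Gamma`). By a QR decomposition every measurement operator of party k is, up
to a local unitary, upper triangular, and such an operator keeps the W form: it multiplies the
squared amplitude of k by some c and the other three by a common a (`exists_measured_form`).
Completeness gives ∑ a = 1 and ∑ c ≤ 1. Taking a out by homogeneity and bounding the remaining
change of one component by a supergradient at the initial point yields `sum_Gamma_le`; induction on
the protocol does the rest.

Concavity is a one-variable matter. With m the largest of the other components, Γ is affine in the
moving component t up to m and equal to P - Q / t + R / t² beyond, so only the signs of the slope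
and of the curvature beyond m and the two slopes at m have to be compared (`exists_supergradient`,
`exists_gammaAt_coeffs`).

That Γ is a function of states follows from local unitary invariants proportional to the products x
i * x j (`exists_pairInvariant_vKet`). They determine x if three components are nonzero. If exactly
two are, the normalization x₀ = 0 fixes the smaller one, on which Γ depends; otherwise Γ = 0. A
measurement may leave two entangled parties with x₀ ≠ 0; passing to the normalized vector then only
lowers Γ (`Gamma_le_of_products`), which is the harmless direction.

An EPR pair along an edge has Γ = 1 and Γ ≥ 0 everywhere, so the success probability is at most the
average of Γ. -/

/-- The value of `Γ` when a 3-edge party has the largest component `m`; `b` is the component of the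
other 3-edge party. -/
noncomputable def gammaThree (m b c d : ℝ) : ℝ :=
  2 * b + (c + d) * (2 - b / m) - 2 * (c * d / m) + 4 / 3 * (b * c * d / m ^ 2)

/-- The value of `Γ` when a 2-edge party has the largest component `m`; `d` is the component of the
other 2-edge party. -/
noncomputable def gammaTwo (m d a b : ℝ) : ℝ :=
  2 * a + 2 * b - a * b / m + d * a * b / (3 * m ^ 2)

/-- The expression for `Γ` when the largest component is that of `n`. -/
noncomputable def gammaAt (n : Fin 4) (x : Fin 4 → ℝ) : ℝ :=
  ![gammaThree (x 0) (x 1) (x 2) (x 3), gammaThree (x 1) (x 0) (x 2) (x 3),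
    gammaTwo (x 2) (x 3) (x 0) (x 1), gammaTwo (x 3) (x 2) (x 0) (x 1)] n

/-- The expression is symmetric in the two parties whose number of edges differs from that of `n1`,
so only the choice of `n1` matters. -/
theorem Roles.Valid.gammaFormula_eq {r : Roles} {x : Fin 4 → ℝ} (h : r.Valid x) :
    gammaFormula x r = gammaAt r.n1 x := by
  obtain ⟨n, c, p, q⟩ := r
  obtain ⟨-, h2, -, h4, h5, h6, h7⟩ := h
  simp only [numEdges_eq] at h2 h4 h5 h6 h7
  have hp : ∀ p : Fin 4, (if p = 0 ∨ p = 1 then 3 else 2) = 2 → p = 2 ∨ p = 3 := by decide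
  have hq : ∀ q : Fin 4, (if q = 0 ∨ q = 1 then 3 else 2) = 3 → q = 0 ∨ q = 1 := by decide
  replace hp := hp p h6
  replace hq := hq q h7
  rcases hp with rfl | rfl <;> rcases hq with rfl | rfl <;> fin_cases n <;> fin_cases c <;>
    first
      | (exfalso; revert h2 h4 h5; decide)
      | (simp [gammaFormula, numEdges_eq, gammaAt, gammaThree, gammaTwo]; try ring)

/-- At a tie between a 3-edge and a 2-edge party the cubic terms match because 4/3 = 1 + 1/3; ties
between parties of the same kind are a mere exchange. -/
theorem gammaAt_eq_of_max {x : Fin 4 → ℝ} (h0 : ∀ i, 0 ≤ x i) {n m : Fin 4}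
    (hn : ∀ i, x i ≤ x n) (hm : ∀ i, x i ≤ x m) : gammaAt n x = gammaAt m x := by
  have e : x n = x m := le_antisymm (hm n) (hn m)
  rcases (h0 n).eq_or_lt with h | h
  · have : ∀ i, x i = 0 := fun i => le_antisymm (h ▸ hn i) (h0 i)
    fin_cases n <;> fin_cases m <;> simp [gammaAt, gammaThree, gammaTwo, this]
  · have h' := h
    rw [e] at h'
    have := h.ne'
    have := h'.ne'
    fin_cases n <;> fin_cases m <;> simp only [gammaAt, gammaThree, gammaTwo] <;>
      simp at * <;> simp only [← e] <;> field_simp <;> ring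

theorem Gamma_eq_gammaAt {x : Fin 4 → ℝ} (h0 : ∀ i, 0 ≤ x i) {n : Fin 4}
    (hn : ∀ i, x i ≤ x n) : Gamma x = gammaAt n x := by
  have h := (exists_roles x).choose_spec
  rw [Gamma, h.gammaFormula_eq]
  exact gammaAt_eq_of_max h0 h.max_n1 hn

/-- Homogeneity allows unnormalized outcomes: probability times Γ of the normalized state becomes Γ
of the squared amplitudes themselves. -/
theorem Gamma_smul {x : Fin 4 → ℝ} (h0 : ∀ i, 0 ≤ x i) {c : ℝ} (hc : 0 ≤ c) :
    Gamma (fun i => c * x i) = c * Gamma x := by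
  obtain ⟨n, hn⟩ := Finite.exists_max x
  rw [Gamma_eq_gammaAt h0 hn, Gamma_eq_gammaAt (n := n) (fun i => mul_nonneg hc (h0 i))
    fun i => mul_le_mul_of_nonneg_left (hn i) hc]
  rcases hc.eq_or_lt with rfl | hc
  · fin_cases n <;> simp [gammaAt, gammaThree, gammaTwo]
  rcases (h0 n).eq_or_lt with h | h
  · have : ∀ i, x i = 0 := fun i => le_antisymm (h ▸ hn i) (h0 i)
    fin_cases n <;> simp [gammaAt, gammaThree, gammaTwo, this]
  · have := h.ne'
    fin_cases n <;> simp [gammaAt, gammaThree, gammaTwo] at * <;> field_simp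

/-- `Γ` vanishes when at most one party is entangled. -/
theorem Gamma_eq_zero {x : Fin 4 → ℝ} (h0 : ∀ i, 0 ≤ x i) {n : Fin 4}
    (h : ∀ i, i ≠ n → x i = 0) : Gamma x = 0 := by
  rw [Gamma_eq_gammaAt (n := n) h0 fun i => by
    by_cases hi : i = n
    · rw [hi]
    · rw [h i hi]; exact h0 n]
  fin_cases n <;> simp [gammaAt, gammaThree, gammaTwo] at * <;> simp [h]

/-! ### Monotonicity and concavity in one component -/

/-- A function that is affine on `[0, m]` and of the form `P - Q / t + R / t ^ 2` beyond has
nonnegative supergradients if its slope is nonnegative and decreasing. -/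
theorem exists_supergradient {f : ℝ → ℝ} {m p q P Q R : ℝ} (hm : 0 < m)
    (h1 : ∀ t, 0 ≤ t → t ≤ m → f t = p + q * t) (h2 : ∀ t, m ≤ t → f t = P - Q / t + R / t ^ 2)
    (hR : 0 ≤ R) (hQ : 3 * R ≤ Q * m) (hq : Q * m - 2 * R ≤ q * m ^ 3) {s : ℝ} (hs : 0 ≤ s) :
    ∃ g, 0 ≤ g ∧ ∀ t, 0 ≤ t → f t ≤ f s + g * (t - s) := by
  have hc : p + q * m = P - Q / m + R / m ^ 2 := by rw [← h1 m hm.le le_rfl, h2 m le_rfl]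
  -- This is the factor that decides the sign in the tangent inequality below; its worst case is s =
  -- t = m, which is 3R ≤ Qm.
  have hQt : ∀ s, m ≤ s → ∀ t, m ≤ t → 0 ≤ Q - R * (2 / s + 1 / t) := by
    intro s hs t ht
    have e1 : 2 / s ≤ 2 / m := by gcongr
    have e2 : 1 / t ≤ 1 / m := by gcongr
    have e3 : R * (2 / s + 1 / t) ≤ R * (3 / m) :=
      mul_le_mul_of_nonneg_left (by rw [show 3 / m = 2 / m + 1 / m by ring]; linarith) hR
    have e4 : R * (3 / m) ≤ Q := by
      rw [← mul_div_assoc, div_le_iff₀ hm]; linarith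
    linarith
  have hQ0 : 0 ≤ Q := by by_contra hh; push Not at hh; nlinarith
  -- Tangent inequality on [m, ∞): the gap is the explicit product (t - s)² / (s² t) · (Q - R (2/s +
  -- 1/t)), so no derivatives are needed.
  have tang : ∀ s, m ≤ s → ∀ t, m ≤ t →
      f t ≤ f s + (Q / s ^ 2 - 2 * R / s ^ 3) * (t - s) := by
    intro s hs t ht
    have hs0 : 0 < s := hm.trans_le hs
    have ht0 : 0 < t := hm.trans_le ht
    rw [h2 s hs, h2 t ht]
    have : (t - s) ^ 2 / (s ^ 2 * t) * (Q - R * (2 / s + 1 / t)) =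
        (P - Q / s + R / s ^ 2 + (Q / s ^ 2 - 2 * R / s ^ 3) * (t - s)) -
          (P - Q / t + R / t ^ 2) := by
      field_simp; ring
    have h3 := mul_nonneg (by positivity : 0 ≤ (t - s) ^ 2 / (s ^ 2 * t)) (hQt s hs t ht)
    linarith
  have hg0 : ∀ s, m ≤ s → 0 ≤ Q / s ^ 2 - 2 * R / s ^ 3 := by
    intro s hs
    have hs0 : 0 < s := hm.trans_le hs
    have : Q / s ^ 2 - 2 * R / s ^ 3 = (Q * s - 2 * R) / s ^ 3 := by field_simp
    rw [this]
    have : Q * m ≤ Q * s := mul_le_mul_of_nonneg_left hs hQ0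
    exact div_nonneg (by linarith) (by positivity)
  have hgq : Q / m ^ 2 - 2 * R / m ^ 3 ≤ q := by
    have : Q / m ^ 2 - 2 * R / m ^ 3 = (Q * m - 2 * R) / m ^ 3 := by field_simp
    rw [this, div_le_iff₀ (by positivity)]
    exact hq
  have hfm : f m = p + q * m := h1 m hm.le le_rfl
  rcases le_total s m with hsm | hsm
  · refine ⟨q, (hg0 m le_rfl).trans hgq, fun t ht => ?_⟩
    rw [h1 s hs hsm]
    rcases le_total t m with htm | htm
    · rw [h1 t ht htm]; linarith
    · have e1 := tang m le_rfl t htm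
      have e2 := mul_le_mul_of_nonneg_right hgq (sub_nonneg.2 htm)
      linarith
  · refine ⟨_, hg0 s hsm, fun t ht => ?_⟩
    rcases le_total t m with htm | htm
    -- Adding the tangent inequalities from s to m and from m to s shows that the slope at s is at
    -- most that at m, hence at most q; the comparison with t then passes through m.
    · have e1 := tang s hsm m le_rfl
      have e2 := tang m le_rfl s hsm
      have e3 : Q / s ^ 2 - 2 * R / s ^ 3 ≤ q := by
        rcases hsm.eq_or_lt with rfl | hlt
        · exact hgq
        · have : (Q / s ^ 2 - 2 * R / s ^ 3) * (s - m) ≤ q * (s - m) := by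
            have := mul_le_mul_of_nonneg_right hgq (sub_nonneg.2 hsm)
            linarith
          exact le_of_mul_le_mul_right this (sub_pos.2 hlt)
      have e4 := mul_le_mul_of_nonneg_right e3 (sub_nonneg.2 htm)
      rw [h1 t ht htm]
      linarith
    · exact tang s hsm t htm

/-- Here k is the moving party and n the largest of the others. The four auxiliary cases are named
by the numbers of edges of k and n; the symmetries of the formulas reduce all twelve pairs to them.
In the first three, the slope drops at the kink by 2(m - c)(m - d) / m², where c, d are the two
remaining components. -/
theorem exists_gammaAt_coeffs {x : Fin 4 → ℝ} (h0 : ∀ i, 0 ≤ x i) {k n : Fin 4} (hkn : k ≠ n)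
    (hn : ∀ i, i ≠ k → x i ≤ x n) (hpos : 0 < x n) :
    ∃ p q P Q R : ℝ, (∀ t, 0 ≤ t → gammaAt n (Function.update x k t) = p + q * t) ∧
      (∀ t, x n ≤ t → gammaAt k (Function.update x k t) = P - Q / t + R / t ^ 2) ∧
      0 ≤ R ∧ 3 * R ≤ Q * x n ∧ Q * x n - 2 * R ≤ q * x n ^ 3 := by
  have three_three : ∀ m c d : ℝ, 0 < m → 0 ≤ c → c ≤ m → 0 ≤ d → d ≤ m →
      ∃ p q P Q R : ℝ, (∀ t, 0 ≤ t → gammaThree m t c d = p + q * t) ∧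
      (∀ t, m ≤ t → gammaThree t m c d = P - Q / t + R / t ^ 2) ∧
      0 ≤ R ∧ 3 * R ≤ Q * m ∧ Q * m - 2 * R ≤ q * m ^ 3 := by
    intro m c d hm hc hcm hd hdm
    refine ⟨2 * (c + d) - 2 * (c * d / m), 2 - (c + d) / m + 4 / 3 * (c * d / m ^ 2),
      2 * m + 2 * (c + d), m * (c + d) + 2 * c * d, 4 / 3 * (m * c * d), ?_, ?_, ?_, ?_, ?_⟩
    · intro t _; simp only [gammaThree]; field_simp; ring
    · intro t ht
      have := hm.trans_le ht
      simp only [gammaThree]; field_simp; ring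
    · positivity
    · have : 0 ≤ m * (c * (m - d) + d * (m - c)) := mul_nonneg hm.le (add_nonneg
        (mul_nonneg hc (sub_nonneg.2 hdm)) (mul_nonneg hd (sub_nonneg.2 hcm)))
      nlinarith
    · have e : (2 - (c + d) / m + 4 / 3 * (c * d / m ^ 2)) * m ^ 3
        = 2 * m ^ 3 - (c + d) * m ^ 2 + 4 / 3 * (c * d * m) := by field_simp
      rw [e]
      have : 0 ≤ m * ((m - d) * (m - c)) := mul_nonneg hm.le
        (mul_nonneg (sub_nonneg.2 hdm) (sub_nonneg.2 hcm))
      nlinarith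
  have three_two : ∀ m b d : ℝ, 0 < m → 0 ≤ b → b ≤ m → 0 ≤ d → d ≤ m →
      ∃ p q P Q R : ℝ, (∀ t, 0 ≤ t → gammaTwo m d t b = p + q * t) ∧
      (∀ t, m ≤ t → gammaThree t b m d = P - Q / t + R / t ^ 2) ∧
      0 ≤ R ∧ 3 * R ≤ Q * m ∧ Q * m - 2 * R ≤ q * m ^ 3 := by
    intro m c d hm hc hcm hd hdm
    refine ⟨2 * c, 2 - c / m + d * c / (3 * m ^ 2),
      2 * c + 2 * (m + d), c * (m + d) + 2 * m * d, 4 / 3 * (c * m * d), ?_, ?_, ?_, ?_, ?_⟩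
    · intro t _; simp only [gammaTwo]; field_simp; ring
    · intro t ht
      have := hm.trans_le ht
      simp only [gammaThree]; field_simp; ring
    · positivity
    · have : 0 ≤ m * (c * (m - d) + 2 * (d * (m - c))) := mul_nonneg hm.le (add_nonneg
        (mul_nonneg hc (sub_nonneg.2 hdm)) (mul_nonneg two_pos.le (mul_nonneg hd (sub_nonneg.2 hcm))))
      nlinarith [mul_nonneg hm.le (mul_nonneg hc hd)]
    · have e : (2 - c / m + d * c / (3 * m ^ 2)) * m ^ 3
        = 2 * m ^ 3 - c * m ^ 2 + 1 / 3 * (d * c * m) := by field_simp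
      rw [e]
      have : 0 ≤ m * ((m - d) * (m - c)) := mul_nonneg hm.le
        (mul_nonneg (sub_nonneg.2 hdm) (sub_nonneg.2 hcm))
      nlinarith
  have two_three : ∀ m b d : ℝ, 0 < m → 0 ≤ b → b ≤ m → 0 ≤ d → d ≤ m →
      ∃ p q P Q R : ℝ, (∀ t, 0 ≤ t → gammaThree m b t d = p + q * t) ∧
      (∀ t, m ≤ t → gammaTwo t d m b = P - Q / t + R / t ^ 2) ∧
      0 ≤ R ∧ 3 * R ≤ Q * m ∧ Q * m - 2 * R ≤ q * m ^ 3 := by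
    intro m c d hm hc hcm hd hdm
    refine ⟨2 * c + d * (2 - c / m), 2 - c / m - 2 * d / m + 4 / 3 * (c * d / m ^ 2),
      2 * m + 2 * c, m * c, d * m * c / 3, ?_, ?_, ?_, ?_, ?_⟩
    · intro t _; simp only [gammaThree]; field_simp; ring
    · intro t ht
      have := hm.trans_le ht
      simp only [gammaTwo]; field_simp
    · positivity
    · nlinarith [mul_nonneg (mul_nonneg hm.le hc) (sub_nonneg.2 hdm)]
    · have e : (2 - c / m - 2 * d / m + 4 / 3 * (c * d / m ^ 2)) * m ^ 3
        = 2 * m ^ 3 - c * m ^ 2 - 2 * d * m ^ 2 + 4 / 3 * (d * c * m) := by field_simp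
      rw [e]
      have : 0 ≤ m * ((m - d) * (m - c)) := mul_nonneg hm.le
        (mul_nonneg (sub_nonneg.2 hdm) (sub_nonneg.2 hcm))
      nlinarith
  -- Both the curvature condition at m and the slope comparison are equalities here, so this case
  -- forces the coefficient 1/3 in Γ.
  have two_two : ∀ m a b : ℝ, 0 < m → 0 ≤ a → a ≤ m → 0 ≤ b → b ≤ m →
      ∃ p q P Q R : ℝ, (∀ t, 0 ≤ t → gammaTwo m t a b = p + q * t) ∧
      (∀ t, m ≤ t → gammaTwo t m a b = P - Q / t + R / t ^ 2) ∧
      0 ≤ R ∧ 3 * R ≤ Q * m ∧ Q * m - 2 * R ≤ q * m ^ 3 := by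
    intro m a b hm ha ham hb hbm
    refine ⟨2 * a + 2 * b - a * b / m, a * b / (3 * m ^ 2),
      2 * a + 2 * b, a * b, m * a * b / 3, ?_, ?_, ?_, ?_, ?_⟩
    · intro t _; simp only [gammaTwo]; field_simp
    · intro t ht
      have := hm.trans_le ht
      simp only [gammaTwo]; field_simp
    · positivity
    · linarith
    · have e : a * b / (3 * m ^ 2) * m ^ 3 = a * b * m / 3 := by field_simp
      rw [e]; linarith
  have symm_three : ∀ m b c d, gammaThree m b c d = gammaThree m b d c := by
    intros; simp only [gammaThree]; ring
  have symm_two : ∀ m b c d, gammaTwo m b c d = gammaTwo m b d c := by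
    intros; simp only [gammaTwo]; ring
  fin_cases k <;> fin_cases n <;> first | exact absurd rfl hkn | skip
  · exact three_three (x 1) (x 2) (x 3) hpos (h0 _) (hn 2 (by decide)) (h0 _) (hn 3 (by decide))
  · exact three_two (x 2) (x 1) (x 3) hpos (h0 _) (hn 1 (by decide)) (h0 _) (hn 3 (by decide))
  · have := three_two (x 3) (x 1) (x 2) hpos (h0 _) (hn 1 (by decide)) (h0 _) (hn 2 (by decide))
    simp_rw [symm_three _ _ (x 3)] at this
    exact this
  · exact three_three (x 0) (x 2) (x 3) hpos (h0 _) (hn 2 (by decide)) (h0 _) (hn 3 (by decide))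
  · have := three_two (x 2) (x 0) (x 3) hpos (h0 _) (hn 0 (by decide)) (h0 _) (hn 3 (by decide))
    simp_rw [symm_two _ _ _ (x 0)] at this
    exact this
  · have := three_two (x 3) (x 0) (x 2) hpos (h0 _) (hn 0 (by decide)) (h0 _) (hn 2 (by decide))
    simp_rw [symm_two _ _ _ (x 0), symm_three _ _ (x 3)] at this
    exact this
  · exact two_three (x 0) (x 1) (x 3) hpos (h0 _) (hn 1 (by decide)) (h0 _) (hn 3 (by decide))
  · have := two_three (x 1) (x 0) (x 3) hpos (h0 _) (hn 0 (by decide)) (h0 _) (hn 3 (by decide))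
    simp_rw [symm_two _ _ _ (x 0)] at this
    exact this
  · exact two_two (x 3) (x 0) (x 1) hpos (h0 _) (hn 0 (by decide)) (h0 _) (hn 1 (by decide))
  · have := two_three (x 0) (x 1) (x 2) hpos (h0 _) (hn 1 (by decide)) (h0 _) (hn 2 (by decide))
    simp_rw [symm_three _ _ _ (x 2)] at this
    exact this
  · have := two_three (x 1) (x 0) (x 2) hpos (h0 _) (hn 0 (by decide)) (h0 _) (hn 2 (by decide))
    simp_rw [symm_two _ _ _ (x 0), symm_three _ _ _ (x 2)] at this
    exact this
  · exact two_two (x 2) (x 0) (x 1) hpos (h0 _) (hn 0 (by decide)) (h0 _) (hn 1 (by decide))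

/-- `Γ` is nondecreasing and concave in each component. -/
theorem exists_supergradient_Gamma {x : Fin 4 → ℝ} (h0 : ∀ i, 0 ≤ x i) (k : Fin 4) :
    ∃ g, 0 ≤ g ∧ ∀ t, 0 ≤ t → Gamma (Function.update x k t) ≤ Gamma x + g * (t - x k) := by
  have hup : ∀ t, 0 ≤ t → ∀ i, 0 ≤ Function.update x k t i := fun t ht i => by
    rw [Function.update_apply]; split_ifs
    exacts [ht, h0 i]
  have : Nonempty {i : Fin 4 // i ≠ k} := (exists_ne k).elim fun i hi => ⟨⟨i, hi⟩⟩
  obtain ⟨⟨n, hnk⟩, hn⟩ := Finite.exists_max fun i : {i : Fin 4 // i ≠ k} => x i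
  have hn : ∀ i, i ≠ k → x i ≤ x n := fun i hi => hn ⟨i, hi⟩
  rcases (h0 n).eq_or_lt with h | h
  -- All other components vanish, so Γ is identically zero along this line.
  · have h' : ∀ i, i ≠ k → x i = 0 := fun i hi => le_antisymm (h ▸ hn i hi) (h0 i)
    refine ⟨0, le_rfl, fun t ht => ?_⟩
    rw [Gamma_eq_zero h0 h', Gamma_eq_zero (n := k) (hup t ht)]
    · simp
    · intro i hi; rw [Function.update_of_ne hi, h' i hi]
  · obtain ⟨p, q, P, Q, R, h1, h2, h3, h4, h5⟩ := exists_gammaAt_coeffs h0 hnk.symm hn h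
    have := exists_supergradient (f := fun t => Gamma (Function.update x k t)) (p := p) (P := P) h ?_ ?_ h3 h4 h5
      (h0 k)
    · simpa using this
    · intro t ht htn
      rw [← h1 t ht]
      refine Gamma_eq_gammaAt (hup t ht) fun i => ?_
      rw [Function.update_of_ne hnk]
      by_cases hi : i = k
      · rw [hi]; simpa
      · rw [Function.update_of_ne hi]; exact hn i hi
    · intro t ht
      rw [← h2 t ht]
      refine Gamma_eq_gammaAt (hup t (h.le.trans ht)) fun i => ?_
      rw [Function.update_self]
      by_cases hi : i = k
      · rw [hi]; simp
      · rw [Function.update_of_ne hi]; exact (hn i hi).trans ht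

/-- `Γ` decreases on average when the components change as in a measurement of party `k`. -/
theorem sum_Gamma_le {x : Fin 4 → ℝ} (h0 : ∀ i, 0 ≤ x i) (k : Fin 4) {m : ℕ} {a c : Fin m → ℝ}
    (ha : ∀ l, 0 ≤ a l) (hc : ∀ l, 0 ≤ c l) (ha1 : ∑ l, a l = 1) (hc1 : ∑ l, c l ≤ 1) :
    ∑ l, Gamma (fun i => (if i = k then c l else a l) * x i) ≤ Gamma x := by
  obtain ⟨g, hg, H⟩ := exists_supergradient_Gamma h0 k
  -- For a l > 0, factor out a l and use the supergradient at t = c l / a l * x k. If a l = 0, only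
  -- party k can survive, so Γ = 0, while the right side is nonnegative because g ≥ 0.
  have key : ∀ l, Gamma (fun i => (if i = k then c l else a l) * x i) ≤
      a l * Gamma x + g * x k * (c l - a l) := by
    intro l
    rcases (ha l).eq_or_lt with h | h
    · rw [Gamma_eq_zero (n := k), ← h]
      · have := mul_nonneg (mul_nonneg hg (h0 k)) (hc l)
        linarith
      · intro i; split_ifs
        exacts [mul_nonneg (hc l) (h0 i), mul_nonneg (ha l) (h0 i)]
      · intro i hi; simp [hi, ← h]
    · have e : (fun i => (if i = k then c l else a l) * x i) =
          fun i => a l * Function.update x k (c l / a l * x k) i := by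
        funext i
        by_cases hi : i = k
        · subst hi; simp; field_simp
        · simp [hi]
      have hnn : 0 ≤ c l / a l * x k := mul_nonneg (div_nonneg (hc l) h.le) (h0 k)
      rw [e, Gamma_smul _ h.le]
      · calc _ ≤ a l * (Gamma x + g * (c l / a l * x k - x k)) :=
              mul_le_mul_of_nonneg_left (H _ hnn) h.le
          _ = _ := by field_simp
      · intro i
        rw [Function.update_apply]; split_ifs
        exacts [hnn, h0 i]
  calc _ ≤ ∑ l, (a l * Gamma x + g * x k * (c l - a l)) := Finset.sum_le_sum fun l _ => key l
    _ = Gamma x + g * x k * (∑ l, c l - 1) := by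
      rw [Finset.sum_add_distrib, ← Finset.sum_mul, ← Finset.mul_sum, Finset.sum_sub_distrib, ha1,
        one_mul]
    _ ≤ _ := by
      have := mul_nonneg (mul_nonneg hg (h0 k)) (sub_nonneg.2 hc1)
      linarith

/-- By monotonicity, setting components to zero one at a time does not raise Γ, and it ends at a
vector with at most one entangled party. -/
theorem Gamma_nonneg {x : Fin 4 → ℝ} (h0 : ∀ i, 0 ≤ x i) : 0 ≤ Gamma x := by
  have step : ∀ y : Fin 4 → ℝ, (∀ i, 0 ≤ y i) → ∀ k, Gamma (Function.update y k 0) ≤ Gamma y := by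
    intro y hy k
    obtain ⟨g, hg, H⟩ := exists_supergradient_Gamma hy k
    have := H 0 le_rfl
    have := mul_nonneg hg (hy k)
    linarith
  have hup : ∀ y : Fin 4 → ℝ, (∀ i, 0 ≤ y i) → ∀ k i, 0 ≤ Function.update y k 0 i := by
    intro y hy k i
    rw [Function.update_apply]; split_ifs
    exacts [le_rfl, hy i]
  have h1 := step x h0 0
  have h2 := step _ (hup x h0 0) 1
  have h3 := step _ (hup _ (hup x h0 0) 1) 2
  have h4 := Gamma_eq_zero (n := 3) (hup _ (hup _ (hup x h0 0) 1) 2) (by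
    intro i hi; fin_cases i <;> simp at hi ⊢)
  linarith

/-! ### Degenerate vectors and equal pairwise products -/

open Classical in
/-- The value of `Γ` when only two parties are entangled. -/
theorem Gamma_of_pair {x : Fin 4 → ℝ} (h0 : ∀ i, 0 ≤ x i) {i j : Fin 4} (hij : i ≠ j)
    (h : ∀ k, k ≠ i → k ≠ j → x k = 0) :
    Gamma x = (if graphIV.Adj i j then 2 else 0) * min (x i) (x j) := by
  wlog hle : x i ≤ x j generalizing i j
  · rw [this hij.symm (fun k h1 h2 => h k h2 h1) (not_le.1 hle).le, min_comm, graphIV.adj_comm]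
  rw [min_eq_left hle, Gamma_eq_gammaAt (n := j) h0 fun k => ?_]
  · fin_cases i <;> fin_cases j <;> simp at hij <;>
      simp [Fin.forall_fin_succ] at h <;> simp [gammaAt, gammaThree, gammaTwo, graphIV, h] <;> ring
  · by_cases h1 : k = i
    · rwa [h1]
    by_cases h2 : k = j
    · rw [h2]
    rw [h k h1 h2]; exact h0 j

/-- Comparison of two component vectors with the same pairwise products. -/
theorem Gamma_le_of_products {x y : Fin 4 → ℝ} {p : ℝ} (hx : ∀ i, 0 ≤ x i) (hy : ∀ i, 0 ≤ y i)
    (hxy : ∀ i j, i ≠ j → x i * x j = y i * y j) (hxp : ∑ i, x i ≤ p)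
    (hyp : {i | y i ≠ 0}.ncard = 2 → ∑ i, y i = p) : Gamma y ≤ Gamma x := by
  by_cases h : ∃ i j, i ≠ j ∧ x i ≠ 0 ∧ x j ≠ 0
  · obtain ⟨i, j, hij, hi, hj⟩ := h
    have hyij : y i * y j ≠ 0 := hxy i j hij ▸ mul_ne_zero hi hj
    have hyi := left_ne_zero_of_mul hyij
    have hyj := right_ne_zero_of_mul hyij
    by_cases h3 : ∃ k, k ≠ i ∧ k ≠ j ∧ x k ≠ 0
    · obtain ⟨k, hki, hkj, hk⟩ := h3
      -- With three nonzero components, x i² = (x i x j)(x k x i) / (x j x k) is determined by the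
      -- products.
      have sq : x i ^ 2 = y i ^ 2 := by
        have e : x i ^ 2 * (x j * x k) = y i ^ 2 * (x j * x k) := by
          calc x i ^ 2 * (x j * x k) = (x i * x j) * (x k * x i) := by ring
            _ = y i ^ 2 * (y j * y k) := by rw [hxy i j hij, hxy k i hki]; ring
            _ = _ := by rw [hxy j k hkj.symm]
        exact mul_right_cancel₀ (mul_ne_zero hj hk) e
      have hie : x i = y i := by
        rwa [sq_eq_sq₀ (hx i) (hy i)] at sq
      have : x = y := by
        funext l
        by_cases hl : l = i
        · rw [hl, hie]
        · have := hxy i l (Ne.symm hl)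
          rw [← hie] at this
          exact mul_left_cancel₀ hi this
      rw [this]
    · push Not at h3
      have hy3 : ∀ k, k ≠ i → k ≠ j → y k = 0 := fun k hki hkj => by
        have := hxy k i hki
        rw [h3 k hki hkj, zero_mul] at this
        exact (mul_eq_zero.1 this.symm).resolve_right hyi
      have hset : {k | y k ≠ 0} = {i, j} := by
        ext k
        simp only [Set.mem_ofPred_eq, Set.mem_insert_iff, Set.mem_singleton_iff]
        constructor
        · intro hk
          by_contra hh
          push Not at hh
          exact hk (hy3 k hh.1 hh.2)
        · rintro (rfl | rfl) <;> assumption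
      have hs : ∀ z : Fin 4 → ℝ, (∀ k, k ≠ i → k ≠ j → z k = 0) → ∑ k, z k = z i + z j := by
        intro z hz
        rw [← Finset.sum_pair hij]
        refine (Finset.sum_subset (Finset.subset_univ _) fun k _ hk => ?_).symm
        simp only [Finset.mem_insert, Finset.mem_singleton, not_or] at hk
        exact hz k hk.1 hk.2
      have hyp := hyp (by rw [hset, Set.ncard_pair hij])
      rw [hs y hy3] at hyp
      rw [hs x h3] at hxp
      rw [Gamma_of_pair hx hij h3, Gamma_of_pair hy hij hy3]
      refine mul_le_mul_of_nonneg_left ?_ (by split_ifs <;> norm_num)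
      have e := hxy i j hij
      have hi' := (hx i).lt_of_ne' hi
      have hj' := (hx j).lt_of_ne' hj
      have hyi' := (hy i).lt_of_ne' hyi
      have hyj' := (hy j).lt_of_ne' hyj
      by_contra hh
      push Not at hh
      rw [lt_min_iff, min_lt_iff, min_lt_iff] at hh
      -- At a fixed product, a pair with a smaller minimum has a larger sum; hence the vector with
      -- the larger sum has the smaller minimum.
      have key : ∀ u v a b : ℝ, 0 < u → u < a → u < b → u * v = a * b → a + b < u + v := by
        intro u v a b hu h1 h2 h3
        have : 0 < (a - u) * (b - u) := mul_pos (sub_pos.2 h1) (sub_pos.2 h2)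
        have : u * (a + b) < u * (u + v) := by nlinarith
        exact lt_of_mul_lt_mul_left this hu.le
      rcases hh with ⟨h1 | h1, h2 | h2⟩
      · have := key _ _ _ _ hi' h1 h2 e; linarith
      · have := mul_lt_mul'' h1 h2 hi'.le hj'.le
        linarith
      · have := mul_lt_mul'' h1 h2 hj'.le hi'.le
        linarith
      · have := key _ _ _ _ hj' h1 h2 ((mul_comm _ _).trans e)
        linarith
  · push Not at h
    have : Gamma y = 0 := by
      by_cases hh : ∃ n, y n ≠ 0
      · obtain ⟨n, hn⟩ := hh
        refine Gamma_eq_zero (n := n) hy fun i hi => ?_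
        have e := hxy i n hi
        have : x i * x n = 0 := by
          by_cases hxi : x i = 0
          · rw [hxi, zero_mul]
          · rw [h i n hi hxi, mul_zero]
        rw [this] at e
        exact (mul_eq_zero.1 e.symm).resolve_right hn
      · push Not at hh
        exact Gamma_eq_zero (n := 0) hy fun i _ => hh i
    rw [this]
    exact Gamma_nonneg hx

/-! ### Local operators -/

/-- The matrix of `applyAll U`. -/
def tensorMatrix (U : Fin 4 → QubitOp) : Matrix (Fin 4 → Fin 2) (Fin 4 → Fin 2) ℂ :=
  Matrix.of fun s t => ∏ k, U k (s k) (t k)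

theorem tensorMatrix_mul (U V : Fin 4 → QubitOp) :
    tensorMatrix (U * V) = tensorMatrix U * tensorMatrix V := by
  ext s t
  simp only [tensorMatrix, Matrix.mul_apply, Matrix.of_apply, Pi.mul_apply,
    ← Finset.prod_mul_distrib]
  rw [Finset.prod_univ_sum, Fintype.piFinset_univ]

theorem tensorMatrix_one : tensorMatrix 1 = 1 := by
  ext s t
  simp only [tensorMatrix, Matrix.of_apply, Pi.one_apply, Matrix.one_apply]
  rw [Finset.prod_ite_zero]
  simp [funext_iff]

theorem tensorMatrix_conjTranspose (U : Fin 4 → QubitOp) :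
    (tensorMatrix U).conjTranspose = tensorMatrix fun k => (U k).conjTranspose := by
  ext s t
  simp [tensorMatrix, Matrix.conjTranspose_apply]

theorem applyAll_eq_mulVec (U : Fin 4 → QubitOp) (ψ : Ket) :
    applyAll U ψ = (tensorMatrix U).mulVec ψ := rfl

theorem applyAll_mul (U V : Fin 4 → QubitOp) (ψ : Ket) :
    applyAll (U * V) ψ = applyAll U (applyAll V ψ) := by
  simp [applyAll_eq_mulVec, tensorMatrix_mul]

theorem applyAll_one (ψ : Ket) : applyAll 1 ψ = ψ := by
  simp [applyAll_eq_mulVec, tensorMatrix_one]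

theorem applyAll_smul (U : Fin 4 → QubitOp) (c : ℂ) (ψ : Ket) :
    applyAll U (c • ψ) = c • applyAll U ψ := by
  simp [applyAll_eq_mulVec, Matrix.mulVec_smul]

theorem applyAt_eq_applyAll (k : Fin 4) (M : QubitOp) (ψ : Ket) :
    applyAt k M ψ = applyAll (Pi.mulSingle k M) ψ := by
  funext s
  -- Only those t contribute that agree with s away from k.
  refine Fintype.sum_of_injective (fun b => Function.update s k b)
    (Function.update_injective s k) _ _ ?_ ?_
  · intro t ht
    have : ∃ j, j ≠ k ∧ s j ≠ t j := by
      by_contra h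
      push Not at h
      refine ht ⟨t k, funext fun j => ?_⟩
      by_cases hj : j = k
      · subst hj; simp
      · simp [hj, h j hj]
    obtain ⟨j, hj, hst⟩ := this
    rw [Finset.prod_eq_zero (Finset.mem_univ j), zero_mul]
    simp [Pi.mulSingle_eq_of_ne hj, hst]
  · intro b
    rw [Finset.prod_eq_single k]
    · simp
    · intro j _ hj
      simp [hj]
    · simp

/-- Each `U k` is unitary. -/
def LocalUnitary (U : Fin 4 → QubitOp) : Prop := ∀ k, U k ∈ Matrix.unitaryGroup (Fin 2) ℂ

theorem LocalUnitary.mul {U V : Fin 4 → QubitOp} (hU : LocalUnitary U) (hV : LocalUnitary V) :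
    LocalUnitary (U * V) := fun k => mul_mem (hU k) (hV k)

theorem LocalUnitary.one : LocalUnitary 1 := fun _ => one_mem _

theorem LocalUnitary.update {U : Fin 4 → QubitOp} (hU : LocalUnitary U) (k : Fin 4) {V : QubitOp}
    (hV : V ∈ Matrix.unitaryGroup (Fin 2) ℂ) : LocalUnitary (Function.update U k V) := by
  intro j
  rw [Function.update_apply]; split_ifs
  exacts [hV, hU j]

theorem LocalUnitary.mulSingle (k : Fin 4) {V : QubitOp}
    (hV : V ∈ Matrix.unitaryGroup (Fin 2) ℂ) : LocalUnitary (Pi.mulSingle k V) :=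
  LocalUnitary.one.update k hV

theorem prob_eq_dotProduct (ψ : Ket) : ((prob ψ : ℝ) : ℂ) = dotProduct (star ψ) ψ := by
  simp [prob, dotProduct, Complex.conj_mul']

theorem prob_applyAll {U : Fin 4 → QubitOp} (hU : LocalUnitary U) (ψ : Ket) :
    prob (applyAll U ψ) = prob ψ := by
  have h : (tensorMatrix U).conjTranspose * tensorMatrix U = 1 := by
    rw [tensorMatrix_conjTranspose, ← tensorMatrix_mul, ← tensorMatrix_one]
    congr 1
    funext k
    exact Matrix.mem_unitaryGroup_iff'.1 (hU k)
  apply Complex.ofReal_injective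
  rw [prob_eq_dotProduct, prob_eq_dotProduct, applyAll_eq_mulVec, Matrix.star_mulVec,
    Matrix.dotProduct_mulVec, Matrix.vecMul_vecMul, h, Matrix.vecMul_one]

theorem prob_applyAt {V : QubitOp} (hV : V ∈ Matrix.unitaryGroup (Fin 2) ℂ) (k : Fin 4) (ψ : Ket) :
    prob (applyAt k V ψ) = prob ψ := by
  rw [applyAt_eq_applyAll, prob_applyAll (LocalUnitary.mulSingle k hV)]

theorem prob_nonneg (ψ : Ket) : 0 ≤ prob ψ := Finset.sum_nonneg fun _ _ => sq_nonneg _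

theorem prob_eq_zero {ψ : Ket} : prob ψ = 0 ↔ ψ = 0 := by
  rw [prob, Finset.sum_eq_zero_iff_of_nonneg fun _ _ => sq_nonneg _]
  simp [funext_iff]

theorem prob_pos {ψ : Ket} (h : ψ ≠ 0) : 0 < prob ψ :=
  (prob_nonneg ψ).lt_of_ne' fun h' => h (prob_eq_zero.1 h')

theorem prob_unitKet {ψ : Ket} (h : ψ ≠ 0) : prob (unitKet ψ) = 1 := by
  have hp := prob_pos h
  have : prob (unitKet ψ) = (Real.sqrt (prob ψ))⁻¹ ^ 2 * prob ψ := by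
    conv_rhs => rw [prob, Finset.mul_sum]
    simp only [prob, unitKet, Pi.smul_apply, smul_eq_mul, norm_mul, Complex.norm_real, mul_pow,
      Real.norm_eq_abs, sq_abs]
  rw [this, inv_pow, Real.sq_sqrt hp.le, inv_mul_cancel₀ hp.ne']

theorem unitKet_eq_self {ψ : Ket} (h : prob ψ = 1) : unitKet ψ = ψ := by
  simp [unitKet, h]

theorem unitKet_applyAll {U : Fin 4 → QubitOp} (hU : LocalUnitary U) (ψ : Ket) :
    unitKet (applyAll U ψ) = applyAll U (unitKet ψ) := by
  rw [unitKet, unitKet, prob_applyAll hU, applyAll_smul]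

theorem norm_det_unitary {V : QubitOp} (hV : V ∈ Matrix.unitaryGroup (Fin 2) ℂ) : ‖V.det‖ = 1 := by
  have := Matrix.det_of_mem_unitary hV
  exact CStarRing.norm_of_mem_unitary this

/-! ### Pairwise invariants -/

/-- Projection of two copies onto the antisymmetric state of the two qubits of party `i`. -/
def antisym (i : Fin 4) (Ψ : (Fin 4 → Fin 2) → Ket) : (Fin 4 → Fin 2) → Ket := fun s t =>
  Ψ (Function.update s i 0) (Function.update t i 1) -
    Ψ (Function.update s i 1) (Function.update t i 0)

/-- The same operator on the qubit of party `k` in two copies. -/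
def applyBoth (k : Fin 4) (V : QubitOp) (Ψ : (Fin 4 → Fin 2) → Ket) : (Fin 4 → Fin 2) → Ket :=
  fun s t => applyAt k V (fun s' => applyAt k V (Ψ s') t) s

/-- A local unitary invariant of a pair of parties, proportional to the squared norm of the
component of two copies that is antisymmetric at `i` and at `j`. -/
noncomputable def pairInvariant (i j : Fin 4) (ψ : Ket) : ℝ :=
  ∑ s, prob (antisym i (antisym j fun s t => ψ s * ψ t) s)

theorem antisym_applyBoth_of_ne {i k : Fin 4} (h : i ≠ k) (V : QubitOp)
    (Ψ : (Fin 4 → Fin 2) → Ket) :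
    antisym i (applyBoth k V Ψ) = applyBoth k V (antisym i Ψ) := by
  funext s t
  simp only [antisym, applyBoth, applyAt, Fin.sum_univ_two, Function.update_of_ne h.symm,
    Function.update_comm h]
  ring

/-- V ⊗ V multiplies the antisymmetric two-qubit state by det V, a phase when V is unitary; hence
the invariance of `pairInvariant`. -/
theorem antisym_applyBoth_self (i : Fin 4) (V : QubitOp) (Ψ : (Fin 4 → Fin 2) → Ket) :
    antisym i (applyBoth i V Ψ) = V.det • antisym i Ψ := by
  funext s t
  simp only [antisym, applyBoth, applyAt, Fin.sum_univ_two, Function.update_self,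
    Function.update_idem, Matrix.det_fin_two, Pi.smul_apply, smul_eq_mul]
  ring

theorem antisym_smul (i : Fin 4) (c : ℂ) (Ψ : (Fin 4 → Fin 2) → Ket) :
    antisym i (c • Ψ) = c • antisym i Ψ := by
  funext s t
  simp only [antisym, Pi.smul_apply, smul_eq_mul]
  ring

theorem sum_prob_applyBoth {V : QubitOp} (hV : V ∈ Matrix.unitaryGroup (Fin 2) ℂ) (k : Fin 4)
    (Ψ : (Fin 4 → Fin 2) → Ket) : ∑ s, prob (applyBoth k V Ψ s) = ∑ s, prob (Ψ s) := by
  calc _ = ∑ t, prob (applyAt k V fun s' => applyAt k V (Ψ s') t) := Finset.sum_comm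
    _ = ∑ t, prob (fun s' => applyAt k V (Ψ s') t) := by simp only [prob_applyAt hV]
    _ = ∑ s, prob (applyAt k V (Ψ s)) := Finset.sum_comm
    _ = _ := by simp only [prob_applyAt hV]

theorem sum_prob_smul {c : ℂ} (hc : ‖c‖ = 1) (Ψ : (Fin 4 → Fin 2) → Ket) :
    ∑ s, prob ((c • Ψ) s) = ∑ s, prob (Ψ s) := by
  simp [prob, hc]

theorem pairInvariant_applyAt {V : QubitOp} (hV : V ∈ Matrix.unitaryGroup (Fin 2) ℂ)
    (i j k : Fin 4) (ψ : Ket) :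
    pairInvariant i j (applyAt k V ψ) = pairInvariant i j ψ := by
  have h : (fun s t => applyAt k V ψ s * applyAt k V ψ t) =
      applyBoth k V fun s t => ψ s * ψ t := by
    funext s t
    simp only [applyBoth, applyAt, Fin.sum_univ_two]
    ring
  have hd := norm_det_unitary hV
  rw [pairInvariant, h]
  by_cases hj : j = k
  · subst hj
    rw [antisym_applyBoth_self, antisym_smul, sum_prob_smul hd, pairInvariant]
  rw [antisym_applyBoth_of_ne hj]
  by_cases hi : i = k
  · subst hi
    rw [antisym_applyBoth_self, sum_prob_smul hd, pairInvariant]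
  rw [antisym_applyBoth_of_ne hi, sum_prob_applyBoth hV, pairInvariant]

theorem pairInvariant_applyAll {U : Fin 4 → QubitOp} (hU : LocalUnitary U)
    (i j : Fin 4) (ψ : Ket) :
    pairInvariant i j (applyAll U ψ) = pairInvariant i j ψ := by
  have h : U = Pi.mulSingle 0 (U 0) * Pi.mulSingle 1 (U 1) * Pi.mulSingle 2 (U 2) *
      Pi.mulSingle 3 (U 3) := by
    funext k
    fin_cases k <;> simp [Pi.mulSingle, Function.update]
  rw [h]
  simp only [applyAll_mul, ← applyAt_eq_applyAll, pairInvariant_applyAt (hU _)]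

/-! ### Vectors of the W form -/

/-- The vector with amplitude `z` at `|0000⟩` and `w i` at the basis vector where only `i` is `1`. -/
def vKet (z : ℂ) (w : Fin 4 → ℂ) : Ket := fun s =>
  if s = 0 then z else ∑ i, if s = Pi.single i 1 then w i else 0

theorem wKet_eq_vKet (x : Fin 4 → ℝ) : wKet x =
    vKet ((Real.sqrt (1 - ∑ i, x i) : ℝ) : ℂ) fun i => ((Real.sqrt (x i) : ℝ) : ℂ) := rfl

theorem bits_cases : ∀ s : Fin 4 → Fin 2,
    s = 0 ∨ (∃ i, s = Pi.single i 1) ∨ ∃ p q, p ≠ q ∧ s p = 1 ∧ s q = 1 := by decide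

theorem vKet_zero (z : ℂ) (w : Fin 4 → ℂ) : vKet z w 0 = z := if_pos rfl

theorem single_injective : Function.Injective fun i : Fin 4 => (Pi.single i 1 : Fin 4 → Fin 2) := by
  decide

theorem vKet_single (z : ℂ) (w : Fin 4 → ℂ) (i : Fin 4) : vKet z w (Pi.single i 1) = w i := by
  rw [vKet, if_neg (by revert i; decide), Finset.sum_eq_single i]
  · simp
  · intro j _ hj
    exact if_neg fun h => hj (single_injective h).symm
  · simp

theorem vKet_of_two (z : ℂ) (w : Fin 4 → ℂ) {s : Fin 4 → Fin 2} {p q : Fin 4} (hpq : p ≠ q)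
    (hp : s p = 1) (hq : s q = 1) : vKet z w s = 0 := by
  rw [vKet, if_neg (by rintro rfl; simp at hp)]
  refine Finset.sum_eq_zero fun i _ => if_neg ?_
  rintro rfl
  have h1 : p = i := by
    by_contra h
    simp [h] at hp
  have h2 : q = i := by
    by_contra h
    simp [h] at hq
  exact hpq (h1.trans h2.symm)

theorem smul_vKet (c z : ℂ) (w : Fin 4 → ℂ) : c • vKet z w = vKet (c * z) fun i => c * w i := by
  funext s
  simp only [Pi.smul_apply, smul_eq_mul, vKet, mul_ite, Finset.mul_sum, mul_zero]

theorem prob_vKet (z : ℂ) (w : Fin 4 → ℂ) : prob (vKet z w) = ‖z‖ ^ 2 + ∑ i, ‖w i‖ ^ 2 := by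
  have h : ‖z‖ ^ 2 + ∑ i, ‖w i‖ ^ 2 =
      ∑ o : Option (Fin 4), o.elim (‖z‖ ^ 2) fun i => ‖w i‖ ^ 2 := by
    rw [Fintype.sum_option]; rfl
  rw [h]
  refine (Fintype.sum_of_injective
    (fun o : Option (Fin 4) => o.elim (0 : Fin 4 → Fin 2) fun i => Pi.single i 1)
    (by decide) _ _ ?_ ?_).symm
  · intro s hs
    rcases bits_cases s with rfl | ⟨i, rfl⟩ | ⟨p, q, hpq, hp, hq⟩
    · exact absurd ⟨none, rfl⟩ hs
    · exact absurd ⟨some i, rfl⟩ hs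
    · rw [vKet_of_two z w hpq hp hq]; simp
  · rintro (_ | i)
    · simp [vKet_zero]
    · simp [vKet_single]

/-- An upper triangular operator preserves the W form. -/
theorem applyAt_vKet (k : Fin 4) {N : QubitOp} (hN : N 1 0 = 0) (z : ℂ) (w : Fin 4 → ℂ) :
    applyAt k N (vKet z w) =
      vKet (N 0 0 * z + N 0 1 * w k) fun i => (if i = k then N 1 1 else N 0 0) * w i := by
  have h01 : ∀ a : Fin 2, a = 0 ∨ a = 1 := by decide
  have hself : ∀ (s : Fin 4 → Fin 2) a, s k = a → Function.update s k a = s := fun s a h => by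
    rw [← h, Function.update_eq_self]
  funext s
  rw [applyAt, Fin.sum_univ_two]
  rcases bits_cases s with rfl | ⟨i, rfl⟩ | ⟨p, q, hpq, hp, hq⟩
  · rw [hself 0 0 rfl, vKet_zero, vKet_zero]
    change _ + _ * vKet z w (Pi.single k 1) = _
    rw [vKet_single]
    rfl
  · by_cases hik : i = k
    · subst hik
      rw [hself _ 1 (by simp), vKet_single, vKet_single]
      simp [hN]
    · have hk : (Pi.single i 1 : Fin 4 → Fin 2) k = 0 := Pi.single_eq_of_ne' hik 1
      rw [hself _ 0 hk, vKet_single, vKet_single, vKet_of_two _ _ hik, hk]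
      · simp [hik]
      · rw [Function.update_of_ne hik, Pi.single_eq_same]
      · rw [Function.update_self]
  · rw [vKet_of_two (N 0 0 * z + N 0 1 * w k) _ hpq hp hq]
    rcases h01 (s k) with hk | hk
    · have hpk : p ≠ k := by rintro rfl; simp [hk] at hp
      have hqk : q ≠ k := by rintro rfl; simp [hk] at hq
      rw [hself _ 0 hk, vKet_of_two z w hpq hp hq, vKet_of_two z w hpq]
      · simp
      · rw [Function.update_of_ne hpk, hp]
      · rw [Function.update_of_ne hqk, hq]
    · rw [hself _ 1 hk, vKet_of_two z w hpq hp hq, hk, hN]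
      simp

/-- Of the four terms of the double antisymmetrization, the two with i and j both excited in one
copy vanish, and these are the only ones that could contain z. The other two each give -w i * w j,
provided all other qubits are 0 in both copies, which is what `g` records. Only C ≠ 0 is needed, not
its value. -/
theorem exists_pairInvariant_vKet {i j : Fin 4} (hij : i ≠ j) :
    ∃ C : ℝ, C ≠ 0 ∧ ∀ z w, pairInvariant i j (vKet z w) = C * (‖w i‖ ^ 2 * ‖w j‖ ^ 2) := by
  classical
  let g : (Fin 4 → Fin 2) → Ket := fun s t =>
    if ∀ k, k ≠ i → k ≠ j → s k = 0 ∧ t k = 0 then 1 else 0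
  have h01 : ∀ a : Fin 2, a ≠ 0 → a = 1 := by decide
  refine ⟨∑ s, ∑ t, 4 * ‖g s t‖ ^ 2, ?_, fun z w => ?_⟩
  · refine (lt_of_lt_of_le (b := 4 * ‖g 0 0‖ ^ 2) (by simp [g]) ?_).ne'
    refine le_trans ?_ (Finset.single_le_sum (f := fun s => ∑ t, 4 * ‖g s t‖ ^ 2)
      (fun s _ => Finset.sum_nonneg fun t _ => by positivity) (Finset.mem_univ 0))
    exact Finset.single_le_sum (f := fun t => 4 * ‖g 0 t‖ ^ 2)
      (fun t _ => by positivity) (Finset.mem_univ 0)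
  have key : ∀ s t, antisym i (antisym j fun s t => vKet z w s * vKet z w t) s t =
      -2 * w i * w j * g s t := by
    intro s t
    let u : (Fin 4 → Fin 2) → Fin 2 → Fin 2 → Fin 4 → Fin 2 := fun s a b =>
      Function.update (Function.update s i a) j b
    have e : antisym i (antisym j fun s t => vKet z w s * vKet z w t) s t =
      vKet z w (u s 0 0) * vKet z w (u t 1 1) - vKet z w (u s 0 1) * vKet z w (u t 1 0) -
        (vKet z w (u s 1 0) * vKet z w (u t 0 1) - vKet z w (u s 1 1) * vKet z w (u t 0 0)) := rfl
    have hi : ∀ s a b, u s a b i = a := fun s a b => by simp [u, hij]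
    have hj : ∀ s a b, u s a b j = b := fun s a b => by simp [u]
    have hk : ∀ s a b k, k ≠ i → k ≠ j → u s a b k = s k := fun s a b k h1 h2 => by
      simp [u, h1, h2]
    have h11 : ∀ s, vKet z w (u s 1 1) = 0 := fun s => vKet_of_two z w hij (hi s 1 1) (hj s 1 1)
    rw [e, h11, h11]
    have hne : ∀ s, (∃ k, k ≠ i ∧ k ≠ j ∧ s k ≠ 0) →
        vKet z w (u s 0 1) = 0 ∧ vKet z w (u s 1 0) = 0 := by
      rintro s ⟨k, h1, h2, h3⟩
      exact ⟨vKet_of_two z w h2 ((hk s 0 1 k h1 h2).trans (h01 _ h3)) (hj s 0 1),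
        vKet_of_two z w h1 ((hk s 1 0 k h1 h2).trans (h01 _ h3)) (hi s 1 0)⟩
    have hz : ∀ s, (∀ k, k ≠ i → k ≠ j → s k = 0) →
        vKet z w (u s 0 1) = w j ∧ vKet z w (u s 1 0) = w i := by
      intro s hs
      have e1 : u s 0 1 = Pi.single j 1 := by
        funext k
        by_cases h2 : k = j
        · rw [h2, hj, Pi.single_eq_same]
        rw [Pi.single_eq_of_ne h2]
        by_cases h1 : k = i
        · rw [h1, hi]
        · rw [hk _ _ _ _ h1 h2, hs k h1 h2]
      have e2 : u s 1 0 = Pi.single i 1 := by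
        funext k
        by_cases h1 : k = i
        · rw [h1, hi, Pi.single_eq_same]
        rw [Pi.single_eq_of_ne h1]
        by_cases h2 : k = j
        · rw [h2, hj]
        · rw [hk _ _ _ _ h1 h2, hs k h1 h2]
      rw [e1, e2, vKet_single, vKet_single]
      exact ⟨rfl, rfl⟩
    by_cases hs : ∀ k, k ≠ i → k ≠ j → s k = 0
    · by_cases ht : ∀ k, k ≠ i → k ≠ j → t k = 0
      · rw [(hz s hs).1, (hz s hs).2, (hz t ht).1, (hz t ht).2]
        simp only [g]
        rw [if_pos fun k h1 h2 => ⟨hs k h1 h2, ht k h1 h2⟩]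
        ring
      · simp only [g]
        rw [if_neg fun h => ht fun k h1 h2 => (h k h1 h2).2]
        push Not at ht
        rw [(hne t ht).1, (hne t ht).2]
        ring
    · simp only [g]
      rw [if_neg fun h => hs fun k h1 h2 => (h k h1 h2).1]
      push Not at hs
      rw [(hne s hs).1, (hne s hs).2]
      ring
  simp only [pairInvariant, prob, key, Finset.sum_mul]
  refine Finset.sum_congr rfl fun s _ => Finset.sum_congr rfl fun t _ => ?_
  simp only [norm_mul, norm_neg, Complex.norm_ofNat]
  ring

/-! ### Normal forms -/

/-- This is the QR decomposition. The first column of V is the normalized first column of N, and the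
second is a unit vector orthogonal to it. -/
theorem exists_triangular (N : QubitOp) :
    ∃ V ∈ Matrix.unitaryGroup (Fin 2) ℂ, ∃ R : QubitOp, R 1 0 = 0 ∧ N = V * R := by
  suffices h : ∃ V ∈ Matrix.unitaryGroup (Fin 2) ℂ, (star V * N) 1 0 = 0 by
    obtain ⟨V, hV, h⟩ := h
    refine ⟨V, hV, star V * N, h, ?_⟩
    rw [← mul_assoc, Matrix.mem_unitaryGroup_iff.1 hV, one_mul]
  by_cases h : N 0 0 = 0 ∧ N 1 0 = 0
  · exact ⟨1, one_mem _, by simp [h.2]⟩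
  have hr : 0 < ‖N 0 0‖ ^ 2 + ‖N 1 0‖ ^ 2 := by
    rcases not_and_or.1 h with h | h
    · have := norm_pos_iff.2 h; positivity
    · have := norm_pos_iff.2 h; positivity
  obtain ⟨r, hr0, hr2⟩ : ∃ r : ℝ, r ≠ 0 ∧ r ^ 2 = ‖N 0 0‖ ^ 2 + ‖N 1 0‖ ^ 2 :=
    ⟨_, (Real.sqrt_pos.2 hr).ne', Real.sq_sqrt hr.le⟩
  have hrc : (r : ℂ) ≠ 0 := by exact_mod_cast hr0
  have hr2' : (r : ℂ) ^ 2 =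
      (starRingEnd ℂ) (N 0 0) * N 0 0 + (starRingEnd ℂ) (N 1 0) * N 1 0 := by
    rw [Complex.conj_mul', Complex.conj_mul']
    exact_mod_cast hr2
  refine ⟨!![N 0 0 / r, -(starRingEnd ℂ) (N 1 0) / r; N 1 0 / r, (starRingEnd ℂ) (N 0 0) / r],
    ?_, ?_⟩
  · rw [Matrix.mem_unitaryGroup_iff']
    ext i j
    fin_cases i <;> fin_cases j <;>
      simp [Matrix.mul_apply, Matrix.star_apply, Fin.sum_univ_two] <;> field_simp <;>
      (try rw [hr2']) <;> ring
  · simp [Matrix.mul_apply, Matrix.star_apply, Fin.sum_univ_two]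
    field_simp
    ring

theorem swap_mem_unitaryGroup : (!![0, 1; 1, 0] : QubitOp) ∈ Matrix.unitaryGroup (Fin 2) ℂ := by
  rw [Matrix.mem_unitaryGroup_iff]
  ext i j
  fin_cases i <;> fin_cases j <;> simp [Matrix.mul_apply, Matrix.star_apply, Fin.sum_univ_two]

open scoped ComplexOrder in
/-- Schmidt decomposition of a two-qubit state of full Schmidt rank. -/
theorem exists_schmidt {M : QubitOp} (hM : M.det ≠ 0) :
    ∃ U ∈ Matrix.unitaryGroup (Fin 2) ℂ, ∃ V ∈ Matrix.unitaryGroup (Fin 2) ℂ, ∃ D : QubitOp,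
      D 0 0 = 0 ∧ D 1 1 = 0 ∧ M = U * D * V.transpose := by
  have hpd : (M.conjTranspose * M).PosDef :=
    Matrix.PosDef.conjTranspose_mul_self M
      (Matrix.mulVec_injective_iff_isUnit.2 ((Matrix.isUnit_iff_isUnit_det M).2 hM.isUnit))
  let W : QubitOp := hpd.isHermitian.eigenvectorUnitary
  have hW : W ∈ Matrix.unitaryGroup (Fin 2) ℂ := hpd.isHermitian.eigenvectorUnitary.2
  let ev := hpd.isHermitian.eigenvalues
  have hev : ∀ i, 0 < ev i := hpd.eigenvalues_pos
  have hspec : M.conjTranspose * M = W * Matrix.diagonal (fun i => (ev i : ℂ)) * star W := by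
    have := hpd.isHermitian.spectral_theorem
    rw [Unitary.conjStarAlgAut_apply] at this
    exact this
  -- Singular value decomposition M = (M W T) S W*, with T inverse to S. Inserting X X = 1 makes the
  -- middle factor S X antidiagonal: amplitudes only on |01⟩ and |10⟩, the W form with z = 0.
  let S : QubitOp := Matrix.diagonal fun i => ((Real.sqrt (ev i) : ℝ) : ℂ)
  let T : QubitOp := Matrix.diagonal fun i => (((Real.sqrt (ev i))⁻¹ : ℝ) : ℂ)
  let X : QubitOp := !![0, 1; 1, 0]
  have hTS : T * S = 1 := by
    rw [Matrix.diagonal_mul_diagonal, ← Matrix.diagonal_one]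
    congr 1; funext i
    rw [← Complex.ofReal_mul, inv_mul_cancel₀ (Real.sqrt_pos.2 (hev i)).ne', Complex.ofReal_one]
  have hTDT : T * Matrix.diagonal (fun i => (ev i : ℂ)) * T = 1 := by
    rw [Matrix.diagonal_mul_diagonal, Matrix.diagonal_mul_diagonal, ← Matrix.diagonal_one]
    congr 1; funext i
    have h1 := (Real.sqrt_pos.2 (hev i)).ne'
    have h2 := Real.sq_sqrt (hev i).le
    rw [← Complex.ofReal_mul, ← Complex.ofReal_mul, ← Complex.ofReal_one]
    congr 1
    rw [← h2, Real.sqrt_sq (Real.sqrt_nonneg _)]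
    field_simp
  have hT : star T = T := by
    rw [Matrix.star_eq_conjTranspose, Matrix.diagonal_conjTranspose]
    congr 1; funext i
    simp
  have hX : X * X = 1 := by
    ext i j
    fin_cases i <;> fin_cases j <;> simp [X, Matrix.mul_apply, Fin.sum_univ_two]
  have hWW := Matrix.mem_unitaryGroup_iff'.1 hW
  have hWW' := Matrix.mem_unitaryGroup_iff.1 hW
  refine ⟨M * W * T, ?_, (X * star W).transpose, ?_, S * X, ?_, ?_, ?_⟩
  · rw [Matrix.mem_unitaryGroup_iff', star_mul, star_mul, hT]
    calc T * (star W * star M) * (M * W * T) = T * (star W * (star M * M) * W) * T := by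
          noncomm_ring
      _ = T * ((star W * W) * Matrix.diagonal (fun i => (ev i : ℂ)) * (star W * W)) * T := by
          rw [Matrix.star_eq_conjTranspose M, hspec]; noncomm_ring
      _ = 1 := by rw [hWW, one_mul, mul_one, hTDT]
  · exact Matrix.transpose_mem_unitaryGroup_iff.2
      (mul_mem swap_mem_unitaryGroup (Unitary.star_mem hW))
  · simp [S, X, Matrix.mul_apply, Fin.sum_univ_two]
  · simp [S, X, Matrix.mul_apply, Fin.sum_univ_two]
  · rw [Matrix.transpose_transpose]
    calc M = M * (W * star W) := by rw [hWW', mul_one]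
      _ = M * W * (T * S) * (X * X) * star W := by rw [hTS, hX]; noncomm_ring
      _ = _ := by noncomm_ring

/-- The state of `i` and `j` with amplitudes `M`, the other parties being in state `|0⟩`. -/
noncomputable def pairKet (i j : Fin 4) (M : QubitOp) : Ket := fun s =>
  open Classical in if ∀ k, k ≠ i → k ≠ j → s k = 0 then M (s i) (s j) else 0

theorem applyAt_pairKet_left {i j : Fin 4} (hij : i ≠ j) (V M : QubitOp) :
    applyAt i V (pairKet i j M) = pairKet i j (V * M) := by
  funext s
  have h : ∀ b, (∀ k, k ≠ i → k ≠ j → Function.update s i b k = 0) ↔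
      ∀ k, k ≠ i → k ≠ j → s k = 0 := fun b =>
    forall₂_congr fun k hk => by rw [Function.update_of_ne hk]
  simp only [applyAt, pairKet, h]
  split_ifs
  · simp [Matrix.mul_apply, Function.update_of_ne hij.symm]
  · simp

theorem applyAt_pairKet_right {i j : Fin 4} (hij : i ≠ j) (V M : QubitOp) :
    applyAt j V (pairKet i j M) = pairKet i j (M * V.transpose) := by
  funext s
  have h : ∀ b, (∀ k, k ≠ i → k ≠ j → Function.update s j b k = 0) ↔
      ∀ k, k ≠ i → k ≠ j → s k = 0 := fun b =>
    forall₃_congr fun k _ hk => by rw [Function.update_of_ne hk]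
  simp only [applyAt, pairKet, h]
  split_ifs
  · simp [Matrix.mul_apply, Function.update_of_ne hij, mul_comm]
  · simp

theorem vKet_eq_pairKet {i j : Fin 4} (hij : i ≠ j) (z : ℂ) {w : Fin 4 → ℂ}
    (h : ∀ k, k ≠ i → k ≠ j → w k = 0) : vKet z w = pairKet i j !![z, w j; w i, 0] := by
  funext s
  rcases bits_cases s with rfl | ⟨l, rfl⟩ | ⟨p, q, hpq, hp, hq⟩
  · simp [vKet_zero, pairKet]
  · rw [vKet_single, pairKet]
    by_cases h1 : l = i
    · subst h1
      have : ∀ k, k ≠ l → k ≠ j → (Pi.single l 1 : Fin 4 → Fin 2) k = 0 :=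
        fun k hk _ => Pi.single_eq_of_ne hk 1
      rw [if_pos this]
      simp [Pi.single_eq_of_ne' hij]
    by_cases h2 : l = j
    · subst h2
      have : ∀ k, k ≠ i → k ≠ l → (Pi.single l 1 : Fin 4 → Fin 2) k = 0 :=
        fun k _ hk => Pi.single_eq_of_ne hk 1
      rw [if_pos this]
      simp [Pi.single_eq_of_ne hij]
    rw [h l h1 h2, if_neg]
    intro hh
    simpa using hh l h1 h2
  · rw [vKet_of_two z w hpq hp hq, pairKet]
    split_ifs with hh
    · have hpij : p = i ∨ p = j := by
        by_contra h'
        push Not at h'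
        simp [hh p h'.1 h'.2] at hp
      have hqij : q = i ∨ q = j := by
        by_contra h'
        push Not at h'
        simp [hh q h'.1 h'.2] at hq
      have : s i = 1 ∧ s j = 1 := by
        rcases hpij with rfl | rfl <;> rcases hqij with rfl | rfl
        · exact absurd rfl hpq
        · exact ⟨hp, hq⟩
        · exact ⟨hq, hp⟩
        · exact absurd rfl hpq
      simp [this.1, this.2]
    · rfl

/-- Local unitary images of vectors of the W form. -/
def IsWForm (ψ : Ket) : Prop := ∃ U z w, LocalUnitary U ∧ ψ = applyAll U (vKet z w)

/-- If only two parties are entangled, the amplitude of `|0000⟩` can be taken to vanish. -/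
theorem IsWForm.exists_normal {ψ : Ket} (h : IsWForm ψ) : ∃ U z w, LocalUnitary U ∧
    ψ = applyAll U (vKet z w) ∧ ({i | w i ≠ 0}.ncard = 2 → z = 0) := by
  obtain ⟨U, z, w, hU, rfl⟩ := h
  by_cases h2 : {i | w i ≠ 0}.ncard = 2
  swap
  · exact ⟨U, z, w, hU, rfl, fun h => absurd h h2⟩
  obtain ⟨i, j, hij, hs⟩ := Set.ncard_eq_two.1 h2
  have hs : ∀ k, w k ≠ 0 ↔ k = i ∨ k = j := fun k => Set.ext_iff.1 hs k
  have hw : ∀ k, k ≠ i → k ≠ j → w k = 0 := fun k h1 h2 =>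
    not_not.1 fun hk => ((hs k).1 hk).elim h1 h2
  have hi : w i ≠ 0 := (hs i).2 (.inl rfl)
  have hj : w j ≠ 0 := (hs j).2 (.inr rfl)
  -- The amplitude matrix of the entangled pair has determinant -w i * w j ≠ 0.
  obtain ⟨A, hA, B, hB, D, hD0, hD1, hM⟩ := exists_schmidt (M := !![z, w j; w i, 0])
    (by simp [Matrix.det_fin_two, hi, hj])
  obtain ⟨w', hi', hj', hw'⟩ : ∃ w' : Fin 4 → ℂ, w' i = D 1 0 ∧ w' j = D 0 1 ∧
      ∀ k, k ≠ i → k ≠ j → w' k = 0 :=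
    ⟨fun k => if k = i then D 1 0 else if k = j then D 0 1 else 0, by simp, by simp [hij.symm],
      fun k h1 h2 => by simp [h1, h2]⟩
  have hD : !![0, w' j; w' i, 0] = D := by
    ext a b
    fin_cases a <;> fin_cases b <;> simp [hi', hj', hD0, hD1]
  have e : vKet z w = applyAt j B (applyAt i A (vKet 0 w')) := by
    rw [vKet_eq_pairKet hij z hw, vKet_eq_pairKet hij 0 hw', applyAt_pairKet_left hij,
      applyAt_pairKet_right hij, hM, hD]
  have hU' : LocalUnitary (U * (Pi.mulSingle j B * Pi.mulSingle i A)) :=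
    hU.mul ((LocalUnitary.mulSingle j hB).mul (LocalUnitary.mulSingle i hA))
  have e' : applyAll U (vKet z w) =
      applyAll (U * (Pi.mulSingle j B * Pi.mulSingle i A)) (vKet 0 w') := by
    rw [e, applyAll_mul, applyAll_mul, ← applyAt_eq_applyAll, ← applyAt_eq_applyAll]
  exact ⟨_, 0, w', hU', e', fun _ => rfl⟩

theorem exists_phase (z : ℂ) : ∃ u : ℂ, ‖u‖ = 1 ∧ z = u * (‖z‖ : ℂ) :=
  ⟨Complex.exp (z.arg * Complex.I), Complex.norm_exp_ofReal_mul_I _, by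
    rw [mul_comm, Complex.norm_mul_exp_arg_mul_I]⟩

theorem applyAll_diagonal (d : Fin 4 → Fin 2 → ℂ) (ψ : Ket) :
    applyAll (fun k => Matrix.diagonal (d k)) ψ = fun s => (∏ k, d k (s k)) * ψ s := by
  funext s
  rw [applyAll, Finset.sum_eq_single s]
  · simp
  · intro t _ hts
    obtain ⟨k, hk⟩ := Function.ne_iff.1 hts
    rw [Finset.prod_eq_zero (Finset.mem_univ k), zero_mul]
    rw [Matrix.diagonal_apply_ne _ hk.symm]
  · simp

/-- Phases of the amplitudes can be removed by local unitaries. -/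
theorem exists_vKet_norm (z : ℂ) (w : Fin 4 → ℂ) : ∃ U, LocalUnitary U ∧
    vKet z w = applyAll U (vKet (‖z‖ : ℂ) fun i => (‖w i‖ : ℂ)) := by
  obtain ⟨u, hu, hz⟩ := exists_phase z
  choose v hv hw using fun i => exists_phase (w i)
  have hu0 : u ≠ 0 := by rintro rfl; simp at hu
  -- The phase u of z is applied once, at party 0, as a global phase; dividing by u on each |1⟩
  -- makes up for it.
  let d : Fin 4 → Fin 2 → ℂ := fun k b => (if k = 0 then u else 1) * if b = 0 then 1 else v k / u
  have hd : ∀ k b, ‖d k b‖ = 1 := by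
    intro k b
    simp only [d, norm_mul]
    split_ifs <;> simp [hu, hv]
  refine ⟨fun k => Matrix.diagonal (d k), fun k => ?_, ?_⟩
  · rw [Matrix.mem_unitaryGroup_iff, Matrix.star_eq_conjTranspose, Matrix.diagonal_conjTranspose,
      Matrix.diagonal_mul_diagonal, ← Matrix.diagonal_one]
    congr 1; funext b
    simp [Complex.mul_conj', hd]
  · rw [applyAll_diagonal]
    funext s
    rcases bits_cases s with rfl | ⟨i, rfl⟩ | ⟨p, q, hpq, hp, hq⟩
    · rw [vKet_zero, vKet_zero]
      simpa [d] using hz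
    · rw [vKet_single, vKet_single]
      have : ∏ k, d k ((Pi.single i 1 : Fin 4 → Fin 2) k) = v i := by
        fin_cases i <;> simp [d, Fin.prod_univ_four] <;> field_simp
      rw [this]
      exact hw i
    · rw [vKet_of_two z w hpq hp hq, vKet_of_two _ _ hpq hp hq, mul_zero]

/-! ### `Γ` as a function of states -/

theorem LUEquiv.pairInvariant_eq {φ ψ : Ket} (h : LUEquiv φ ψ) (i j : Fin 4) :
    pairInvariant i j ψ = pairInvariant i j φ := by
  obtain ⟨U, hU, rfl⟩ := h
  exact pairInvariant_applyAll hU i j φ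

theorem pairInvariant_wKet {x : Fin 4 → ℝ} (hx : ∀ i, 0 ≤ x i) {i j : Fin 4} {C : ℝ}
    (hC : ∀ z w, pairInvariant i j (vKet z w) = C * (‖w i‖ ^ 2 * ‖w j‖ ^ 2)) :
    pairInvariant i j (wKet x) = C * (x i * x j) := by
  rw [wKet_eq_vKet, hC]
  simp [Real.sq_sqrt, hx]

theorem prod_eq_of_LUEquiv {x y : Fin 4 → ℝ} (hx : ∀ i, 0 ≤ x i) (hy : ∀ i, 0 ≤ y i) {ψ : Ket}
    (h1 : LUEquiv (wKet x) ψ) (h2 : LUEquiv (wKet y) ψ) {i j : Fin 4} (hij : i ≠ j) :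
    x i * x j = y i * y j := by
  obtain ⟨C, hC0, hC⟩ := exists_pairInvariant_vKet hij
  have := (h1.pairInvariant_eq i j).symm.trans (h2.pairInvariant_eq i j)
  rw [pairInvariant_wKet hx hC, pairInvariant_wKet hy hC] at this
  exact mul_left_cancel₀ hC0 this

/-- Two component vectors of one state have equal pairwise products and are both normalized, so the
comparison applies in both directions. -/
theorem GammaState_eq {x : Fin 4 → ℝ} (hx : IsWVector x) {ψ : Ket} (h : LUEquiv (wKet x) ψ) :
    GammaState ψ = Gamma x := by
  have hex : ∃ x, IsWVector x ∧ LUEquiv (wKet x) ψ := ⟨x, hx, h⟩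
  rw [GammaState, dif_pos hex]
  obtain ⟨hy, h'⟩ := hex.choose_spec
  have hprod : ∀ i j, i ≠ j → x i * x j = hex.choose i * hex.choose j := fun i j hij =>
    prod_eq_of_LUEquiv hx.1.1 hy.1.1 h h' hij
  exact le_antisymm (Gamma_le_of_products hx.1.1 hy.1.1 hprod hx.1.2 hy.2)
    (Gamma_le_of_products hy.1.1 hx.1.1 (fun i j hij => (hprod i j hij).symm) hy.1.2 hx.2)

theorem GammaState_nonneg (ψ : Ket) : 0 ≤ GammaState ψ := by
  rw [GammaState]
  split_ifs with h
  · exact Gamma_nonneg h.choose_spec.1.1.1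
  · exact le_rfl

theorem vKet_norm_eq_wKet {z : ℂ} {w : Fin 4 → ℂ} (h : prob (vKet z w) = 1) :
    (vKet (‖z‖ : ℂ) fun i => (‖w i‖ : ℂ)) = wKet fun i => ‖w i‖ ^ 2 := by
  rw [prob_vKet] at h
  rw [wKet_eq_vKet, ← h, add_sub_cancel_right, Real.sqrt_sq (norm_nonneg z)]
  congr 1
  funext i
  rw [Real.sqrt_sq (norm_nonneg _)]

theorem unitKet_vKet_form {U : Fin 4 → QubitOp} (hU : LocalUnitary U) (z : ℂ) (w : Fin 4 → ℂ) :
    unitKet (applyAll U (vKet z w)) = applyAll U (vKet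
      (((Real.sqrt (prob (vKet z w)))⁻¹ : ℝ) * z)
      fun i => ((Real.sqrt (prob (vKet z w)))⁻¹ : ℝ) * w i) := by
  rw [unitKet_applyAll hU, unitKet, smul_vKet]

theorem applyAll_ne_zero {U : Fin 4 → QubitOp} (hU : LocalUnitary U) {ψ : Ket}
    (h : applyAll U ψ ≠ 0) : ψ ≠ 0 := by
  rwa [Ne, ← prob_eq_zero, prob_applyAll hU, prob_eq_zero] at h

/-- A nonzero vector of the W form is, up to local unitaries and normalization, given by its squared
amplitudes. -/
theorem LUEquiv_unitKet {U : Fin 4 → QubitOp} (hU : LocalUnitary U) {z : ℂ} {w : Fin 4 → ℂ}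
    (h : vKet z w ≠ 0) : LUEquiv (wKet fun i => ‖w i‖ ^ 2 / prob (vKet z w))
      (unitKet (applyAll U (vKet z w))) := by
  have hp := prob_pos h
  have h1 := prob_unitKet h
  rw [unitKet, smul_vKet] at h1
  rw [unitKet_vKet_form hU]
  obtain ⟨V, hV, e⟩ := exists_vKet_norm (((Real.sqrt (prob (vKet z w)))⁻¹ : ℝ) * z)
      fun i => ((Real.sqrt (prob (vKet z w)))⁻¹ : ℝ) * w i
  refine ⟨U * V, hU.mul hV, ?_⟩
  rw [e, applyAll_mul, vKet_norm_eq_wKet h1]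
  congr 3
  funext i
  rw [norm_mul, Complex.norm_real, mul_pow, Real.norm_eq_abs, sq_abs, inv_pow, Real.sq_sqrt hp.le]
  ring

theorem isWVector_of_normal {z : ℂ} {w : Fin 4 → ℂ} (h : vKet z w ≠ 0)
    (hw : {i | w i ≠ 0}.ncard = 2 → z = 0) :
    IsWVector fun i => ‖w i‖ ^ 2 / prob (vKet z w) := by
  have hp := prob_pos h
  have hs : ∑ i, ‖w i‖ ^ 2 / prob (vKet z w) = (prob (vKet z w) - ‖z‖ ^ 2) / prob (vKet z w) := by
    rw [← Finset.sum_div]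
    congr 1
    rw [prob_vKet]; ring
  refine ⟨⟨fun i => by positivity, ?_⟩, fun hc => ?_⟩
  · rw [hs, div_le_one hp]
    have := sq_nonneg ‖z‖
    linarith
  · have : {i | ‖w i‖ ^ 2 / prob (vKet z w) ≠ 0} = {i | w i ≠ 0} := by
      ext i
      simp [hp.ne']
    rw [this] at hc
    rw [hs, hw hc, norm_zero, zero_pow two_ne_zero, sub_zero, ← hw hc, div_self hp.ne']

theorem IsWForm.unitKet_mem {ψ : Ket} (h : IsWForm ψ) (h0 : ψ ≠ 0) : unitKet ψ ∈ WClass := by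
  obtain ⟨U, z, w, hU, rfl, hw⟩ := h.exists_normal
  have h0 := applyAll_ne_zero hU h0
  exact ⟨_, isWVector_of_normal h0 hw, LUEquiv_unitKet hU h0⟩

/-- The contribution of an unnormalized outcome to the average of `Γ`. -/
noncomputable def weightedGamma (ψ : Ket) : ℝ := prob ψ * GammaState (unitKet ψ)

theorem mul_Gamma_div {z : ℂ} {w : Fin 4 → ℂ} (h : vKet z w ≠ 0) :
    prob (vKet z w) * Gamma (fun i => ‖w i‖ ^ 2 / prob (vKet z w)) =
      Gamma fun i => ‖w i‖ ^ 2 := by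
  have hp := prob_pos h
  rw [← Gamma_smul (fun i => by positivity) hp.le]
  congr 1
  funext i
  field_simp

/-- Used for measurement outcomes: z may be nonzero with two entangled parties, and then the squared
amplitudes need not form an admissible component vector. An admissible one has the same products and
no larger Γ. -/
theorem weightedGamma_le {U : Fin 4 → QubitOp} (hU : LocalUnitary U) (z : ℂ) (w : Fin 4 → ℂ) :
    weightedGamma (applyAll U (vKet z w)) ≤ Gamma fun i => ‖w i‖ ^ 2 := by
  rw [weightedGamma]
  by_cases h0 : vKet z w = 0
  · rw [prob_applyAll hU, prob_eq_zero.2 h0, zero_mul]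
    exact Gamma_nonneg fun i => sq_nonneg _
  have hp := prob_pos h0
  have h0' : applyAll U (vKet z w) ≠ 0 := by
    rwa [Ne, ← prob_eq_zero, prob_applyAll hU, prob_eq_zero]
  obtain ⟨y, hy, hyψ⟩ := IsWForm.unitKet_mem ⟨U, z, w, hU, rfl⟩ h0'
  rw [GammaState_eq hy hyψ, prob_applyAll hU, ← mul_Gamma_div h0]
  refine mul_le_mul_of_nonneg_left ?_ hp.le
  refine Gamma_le_of_products (p := 1) (fun i => by positivity) hy.1.1 (fun i j hij =>
    prod_eq_of_LUEquiv (fun i => by positivity) hy.1.1 (LUEquiv_unitKet hU h0) hyψ hij) ?_ hy.2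
  rw [← Finset.sum_div, div_le_one hp, prob_vKet]
  have := sq_nonneg ‖z‖
  linarith

/-- Used for the state before the measurement, where an inequality would go the wrong way and the
normal form is therefore required. -/
theorem weightedGamma_eq {U : Fin 4 → QubitOp} (hU : LocalUnitary U) {z : ℂ} {w : Fin 4 → ℂ}
    (hw : {i | w i ≠ 0}.ncard = 2 → z = 0) :
    weightedGamma (applyAll U (vKet z w)) = Gamma fun i => ‖w i‖ ^ 2 := by
  rw [weightedGamma, prob_applyAll hU]
  by_cases h0 : vKet z w = 0
  · rw [prob_eq_zero.2 h0, zero_mul, Gamma_eq_zero (n := 0) fun i => sq_nonneg _]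
    intro i _
    rw [← vKet_single z w i, h0]
    simp
  · rw [GammaState_eq (isWVector_of_normal h0 hw) (LUEquiv_unitKet hU h0), mul_Gamma_div h0]

/-! ### Monotonicity under measurements -/

/-- The effect of a measurement operator on a vector of the W form. -/
theorem exists_measured_form (U : Fin 4 → QubitOp) (k : Fin 4)
    (M : QubitOp) : ∃ V ∈ Matrix.unitaryGroup (Fin 2) ℂ, ∃ R : QubitOp, R 1 0 = 0 ∧
      M * U k = V * R ∧ ∀ z w, applyAt k M (applyAll U (vKet z w)) =
        applyAll (Function.update U k V) (vKet (R 0 0 * z + R 0 1 * w k)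
          fun i => (if i = k then R 1 1 else R 0 0) * w i) := by
  obtain ⟨V, hV, R, hR, e⟩ := exists_triangular (M * U k)
  refine ⟨V, hV, R, hR, e, fun z w => ?_⟩
  rw [← applyAt_vKet k hR, applyAt_eq_applyAll, applyAt_eq_applyAll, ← applyAll_mul,
    ← applyAll_mul]
  congr 1
  funext j
  by_cases hj : j = k
  · subst hj
    simp [e]
  · simp [hj]

theorem IsWForm.applyAt {ψ : Ket} (h : IsWForm ψ) (k : Fin 4) (M : QubitOp) :
    IsWForm (applyAt k M ψ) := by
  obtain ⟨U, z, w, hU, rfl⟩ := h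
  obtain ⟨V, hV, R, -, -, e⟩ := exists_measured_form U k M
  exact ⟨_, _, _, hU.update k hV, e z w⟩

theorem IsWForm.sum_weightedGamma_le {ψ : Ket} (h : IsWForm ψ) (k : Fin 4) {m : ℕ}
    {M : Fin m → QubitOp} (hM : ∑ l, (M l).conjTranspose * M l = 1) :
    ∑ l, weightedGamma (_root_.applyAt k (M l) ψ) ≤ weightedGamma ψ := by
  obtain ⟨U, z, w, hU, rfl, hw⟩ := h.exists_normal
  choose V hV R hR e he using fun l => exists_measured_form U k (M l)
  -- Since R l = V l* M l U k, the triangular operators again form a complete measurement.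
  have hR1 : ∑ l, (R l).conjTranspose * R l = 1 := by
    calc ∑ l, (R l).conjTranspose * R l
        = ∑ l, star (U k) * ((M l).conjTranspose * M l) * U k := by
          refine Finset.sum_congr rfl fun l _ => ?_
          calc (R l).conjTranspose * R l = (R l).conjTranspose * (star (V l) * V l) * R l := by
                rw [Matrix.mem_unitaryGroup_iff'.1 (hV l), mul_one]
            _ = (V l * R l).conjTranspose * (V l * R l) := by
                rw [Matrix.conjTranspose_mul, Matrix.star_eq_conjTranspose]
                simp only [mul_assoc]
            _ = _ := by
                rw [← e l, Matrix.conjTranspose_mul, Matrix.star_eq_conjTranspose]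
                simp only [mul_assoc]
      _ = 1 := by
          rw [← Finset.sum_mul, ← Finset.mul_sum, hM, mul_one,
            Matrix.mem_unitaryGroup_iff'.1 (hU k)]
  have ha : ∑ l, ‖R l 0 0‖ ^ 2 = 1 := by
    have := congrFun (congrFun hR1 0) 0
    simp only [Matrix.sum_apply, Matrix.mul_apply, Fin.sum_univ_two, Matrix.conjTranspose_apply,
      hR, add_zero, Matrix.one_apply_eq, Complex.star_def, Complex.conj_mul',
      norm_zero, Complex.ofReal_zero, ne_eq, OfNat.ofNat_ne_zero, not_false_eq_true,
      zero_pow] at this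
    exact_mod_cast this
  have hc : ∑ l, (‖R l 0 1‖ ^ 2 + ‖R l 1 1‖ ^ 2) = 1 := by
    have := congrFun (congrFun hR1 1) 1
    simp only [Matrix.sum_apply, Matrix.mul_apply, Fin.sum_univ_two, Matrix.conjTranspose_apply,
      Matrix.one_apply_eq, Complex.star_def, Complex.conj_mul'] at this
    exact_mod_cast this
  -- The weight of R 0 1 goes into |0000⟩ and is lost to party k, so only an inequality remains;
  -- monotonicity in the component of k absorbs it.
  have hc' : ∑ l, ‖R l 1 1‖ ^ 2 ≤ 1 := by
    rw [← hc]
    refine Finset.sum_le_sum fun l _ => ?_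
    have := sq_nonneg ‖R l 0 1‖
    linarith
  rw [weightedGamma_eq hU hw]
  refine le_trans (Finset.sum_le_sum fun l _ => ?_)
    (sum_Gamma_le (fun i => sq_nonneg ‖w i‖) k (fun l => sq_nonneg ‖R l 0 0‖)
      (fun l => sq_nonneg ‖R l 1 1‖) ha hc')
  rw [he l]
  refine (weightedGamma_le (hU.update k (hV l)) _ _).trans_eq ?_
  congr 1
  funext i
  split_ifs <;> rw [norm_mul, mul_pow]

theorem sum_map_finset_sum {ι α : Type*} (s : Finset ι) (O : ι → Multiset α) (f : α → ℝ) :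
    ((∑ l ∈ s, O l).map f).sum = ∑ l ∈ s, ((O l).map f).sum := by
  classical
  induction s using Finset.induction_on with
  | empty => simp
  | insert a s ha ih => simp [Finset.sum_insert ha, ih]

theorem IsWForm.of_mem_outcomes {ψ φ : Ket} (P : Protocol) (h : IsWForm ψ)
    (hφ : φ ∈ P.outcomes ψ) : IsWForm φ := by
  induction P generalizing ψ with
  | done =>
    rw [Protocol.outcomes, Multiset.mem_singleton] at hφ
    rwa [hφ]
  | measure k m M complete next ih =>
    rw [Protocol.outcomes, Multiset.mem_sum] at hφ
    obtain ⟨l, -, hl⟩ := hφ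
    exact ih l (h.applyAt k (M l)) hl

theorem IsWForm.average_le {ψ : Ket} (P : Protocol) (h : IsWForm ψ) :
    P.average GammaState ψ ≤ weightedGamma ψ := by
  induction P generalizing ψ with
  | done => simp [Protocol.average, Protocol.outcomes, weightedGamma]
  | measure k m M complete next ih =>
    rw [Protocol.average, Protocol.outcomes, sum_map_finset_sum]
    exact (Finset.sum_le_sum fun l _ => ih l (h.applyAt k (M l))).trans
      (h.sum_weightedGamma_le k complete)

theorem isWForm_of_LUEquiv {x : Fin 4 → ℝ} {ψ : Ket} (h : LUEquiv (wKet x) ψ) : IsWForm ψ := by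
  obtain ⟨U, hU, rfl⟩ := h
  exact ⟨U, _, _, hU, rfl⟩

theorem LUEquiv.refl (ψ : Ket) : LUEquiv ψ ψ := ⟨1, LocalUnitary.one, (applyAll_one ψ).symm⟩

theorem prob_wKet {x : Fin 4 → ℝ} (hx : IsComponents x) : prob (wKet x) = 1 := by
  rw [wKet_eq_vKet, prob_vKet]
  simp [Real.sq_sqrt, hx.1, Real.sq_sqrt (sub_nonneg.2 hx.2)]

/-- `Γ` bounds the average at the final states for arbitrary components. -/
theorem average_wKet_le {x : Fin 4 → ℝ} (hx : IsComponents x) (P : Protocol) :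
    P.average GammaState (wKet x) ≤ Gamma x := by
  refine ((isWForm_of_LUEquiv (LUEquiv.refl (wKet x))).average_le P).trans ?_
  -- The vector x may have exactly two nonzero entries and x₀ > 0, so the inequality is used rather
  -- than `GammaState_eq`.
  have := weightedGamma_le LocalUnitary.one ((Real.sqrt (1 - ∑ i, x i) : ℝ) : ℂ)
    fun i => ((Real.sqrt (x i) : ℝ) : ℂ)
  rw [applyAll_one, ← wKet_eq_vKet] at this
  refine this.trans_eq ?_
  congr 1
  funext i
  simp [Real.sq_sqrt, hx.1]

theorem isEntanglementMonotone_GammaState : IsEntanglementMonotone WClass GammaState := by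
  rintro ψ ⟨x, hx, U, hU, rfl⟩ P
  have hW : IsWForm (applyAll U (wKet x)) := isWForm_of_LUEquiv ⟨U, hU, rfl⟩
  refine ⟨fun φ hφ h0 => (hW.of_mem_outcomes P hφ).unitKet_mem h0, (hW.average_le P).trans_eq ?_⟩
  have hp : prob (applyAll U (wKet x)) = 1 := by rw [prob_applyAll hU, prob_wKet hx.1]
  rw [weightedGamma, unitKet_eq_self hp, hp, one_mul]

/-! ### Random distillation -/

theorem epr_eq_pairKet {i j : Fin 4} (hij : i ≠ j) :
    epr i j = pairKet i j ((((Real.sqrt 2)⁻¹ : ℝ) : ℂ) • 1) := by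
  have key : ∀ i j : Fin 4, i ≠ j → ∀ s : Fin 4 → Fin 2,
      (s = 0 ∨ s = Pi.single i 1 + Pi.single j 1) ↔
        (∀ k, k ≠ i → k ≠ j → s k = 0) ∧ s i = s j := by decide
  funext s
  simp only [epr, pairKet, key i j hij s, ite_and, Matrix.smul_apply, Matrix.one_apply,
    smul_eq_mul, mul_ite, mul_one, mul_zero]

/-- Flipping the qubit of j turns the EPR pair into the W form with components 1/2, 1/2, and on an
edge Γ is twice the smaller component. -/
theorem GammaState_of_isTarget {ψ : Ket} (h : IsTarget graphIV ψ) : GammaState ψ = 1 := by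
  obtain ⟨i, j, hadj, U, hU, rfl⟩ := h
  have hij := hadj.ne
  let x : Fin 4 → ℝ := fun k => if k = i ∨ k = j then 1 / 2 else 0
  have hx0 : ∀ k, 0 ≤ x k := fun k => by
    simp only [x]; split_ifs <;> norm_num
  have hxk : ∀ k, k ≠ i → k ≠ j → x k = 0 := fun k h1 h2 => if_neg (not_or.2 ⟨h1, h2⟩)
  have hxi : x i = 1 / 2 := if_pos (.inl rfl)
  have hxj : x j = 1 / 2 := if_pos (.inr rfl)
  have hs : ∑ k, x k = 1 := by
    rw [Fintype.sum_eq_add i j hij fun k hk => hxk k hk.1 hk.2, hxi, hxj]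
    norm_num
  have hx : IsWVector x := ⟨⟨hx0, hs.le⟩, fun _ => hs⟩
  have e : epr i j = applyAt j !![0, 1; 1, 0] (wKet x) := by
    rw [epr_eq_pairKet hij, wKet_eq_vKet, vKet_eq_pairKet hij, applyAt_pairKet_right hij]
    · congr 1
      rw [hs, hxi, hxj]
      ext a b
      fin_cases a <;> fin_cases b <;> simp [Matrix.mul_apply, Fin.sum_univ_two]
    · intro k h1 h2
      simp [hxk k h1 h2]
  have hψ : LUEquiv (wKet x) (applyAll U (epr i j)) := by
    refine ⟨U * Pi.mulSingle j !![0, 1; 1, 0],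
      LocalUnitary.mul hU (LocalUnitary.mulSingle j swap_mem_unitaryGroup), ?_⟩
    rw [applyAll_mul, ← applyAt_eq_applyAll, e]
  rw [GammaState_eq hx hψ, Gamma_of_pair hx0 hij hxk, hxi, hxj, if_pos hadj]
  norm_num

/-- The indicator of success is bounded by `GammaState`: equal to 1 on targets, nonnegative
elsewhere. -/
theorem successProb_le {x : Fin 4 → ℝ} (hx : IsComponents x) (P : Protocol) :
    P.successProb graphIV (wKet x) ≤ Gamma x := by
  refine le_trans (Multiset.sum_map_le_sum_map _ _ fun φ _ => ?_) (average_wKet_le hx P)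
  refine mul_le_mul_of_nonneg_left ?_ (prob_nonneg φ)
  dsimp only
  split_ifs with h
  · rw [GammaState_of_isTarget h]
  · exact GammaState_nonneg _

theorem Gamma_quarter : Gamma (fun _ => 1 / 4) = 5 / 6 := by
  rw [Gamma_eq_gammaAt (n := 0) (fun _ => by norm_num) fun _ => le_rfl]
  norm_num [gammaAt, gammaThree]

/-- `Γ` is well defined: its value depends neither on the choice of the parties at ties nor on the
component vector that represents the state. It is an entanglement monotone on the W-class states,
it bounds the optimal probability of random distillation for configuration IV, and its value at
the standard W state of four qubits is `5/6`. -/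
theorem theorem2 :
    (∀ x : Fin 4 → ℝ, IsComponents x → ∀ r : Roles, r.Valid x → Gamma x = gammaFormula x r) ∧
    (∀ x : Fin 4 → ℝ, IsWVector x → ∀ ψ : Ket, LUEquiv (wKet x) ψ → GammaState ψ = Gamma x) ∧
    IsEntanglementMonotone WClass GammaState ∧
    (∀ x : Fin 4 → ℝ, IsComponents x →
      BddAbove (Set.range fun P : Protocol => P.successProb graphIV (wKet x)) ∧
      distillProb (wKet x) graphIV ≤ Gamma x) ∧
    Gamma (fun _ => 1 / 4) = 5 / 6 := by
  refine ⟨fun x hx r hr => ?_, fun x hx ψ h => GammaState_eq hx h,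
    isEntanglementMonotone_GammaState, fun x hx => ⟨⟨Gamma x, ?_⟩, ?_⟩, Gamma_quarter⟩
  · rw [hr.gammaFormula_eq]
    exact Gamma_eq_gammaAt hx.1 hr.max_n1
  · rintro _ ⟨P, rfl⟩
    exact successProb_le hx P
  · have : Nonempty Protocol := ⟨.done⟩
    exact ciSup_le fun P => successProb_le hx P
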